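/- A commutative binoid is a commutative monoid $(N,+,0)$ with an absorbing element $\infty$ (so $\infty+a=\infty$ for all $a$); put $N^\bullet=N\setminus\{\infty\}$ and let $N_+$ be the set of non-units. An ideal is a nonempty subset $I\subseteq N$ with $I+N\subseteq I$; it is $N_+$-primary if $\{a\in N: na\in I\text{ for some }n\in\mathbb N\}=N_+$. For $q\ge 1$ let $[q]I$ be the ideal generated by $\{qa : a\in I\}$, let $N/J$ be the binoid obtained from $N$ by collapsing the ideal $J$ to $\infty$, and let $\#S$ be the number of elements of $S$ other than $\infty$. Let $\dim N$ be the supremum of the lengths of strictly increasing chains of prime ideals of $N$, and let $\operatorname{diff}N$ be the difference binoid, that is, the localization of $N$ at the submonoid generated by $N^\bullet$. An integral and cancellative binoid $N$ is normal if every $x\in\operatorname{diff}N$ with $nx\in N$ for some $n\ge1$ lies in $N$. **Theorem.** Let $N$ be a finitely generated, positive (i.e. $N\neq\{\infty\}$ and $0$ is the only unit), integral ($a+b=\infty$ implies $a=\infty$ or $b=\infty$), cancellative ($a+c=b+c\ne\infty$ implies $a=b$), torsion-free ($na=nb$ with $n\ge1$ implies $a=b$) and normal commutative binoid, and let $\mathfrak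 n$ be an $N_+$-primary ideal of $N$. Then $d=\dim N$ is finite, $N/[q]\mathfrak n$ is finite for every $q\geq 1$, and the Hilbert–Kunz multiplicity $$e_{HK}(\mathfrak n,N)=\lim_{q\to\infty}\frac{\#\,N/[q]\mathfrak n}{q^{d}}$$ exists and is a rational number. Moreover the difference group $(\operatorname{diff}N)^\times$ (the group of units of $\operatorname{diff}N$) is isomorphic to $\mathbb Z^d$, and for every identification $(\operatorname{diff}N)^\times\cong\mathbb Z^d\subset\mathbb R^d$ and every set $A\subseteq N$ that generates the ideal $\mathfrak n$ the following holds: if $C=\mathbb R_{\geq 0}N^\bullet\subseteq\mathbb R^d$ is the cone generated by the image of $N^\bullet$, then the region $$B=C\setminus\bigcup_{a\in A,\ a\neq\infty}(a+C)$$ is bounded and its $d$-dimensional Lebesgue volume is $e_{HK}(\mathfrak n,N)$. -/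

import Mathlib

open Filter Topology MeasureTheory

/-- A commutative binoid: a commutative additive monoid with an absorbing element `∞`. -/
class Binoid (N : Type*) extends AddCommMonoid N where
  /-- the absorbing element `∞` -/
  infty : N
  infty_add : ∀ a : N, infty + a = infty

namespace Binoid

section Properties

variable (N : Type*) [Binoid N]

/-- `N` is finitely generated as a binoid: some finite set generates `N` under addition,
where `0` and `∞` come for free. -/
def IsFinitelyGenerated : Prop :=
  ∃ S : Finset N, AddSubmonoid.closure (insert infty (S : Set N)) = ⊤

/-- `N` is positive: it is nonzero and `0` is its only unit. -/
def IsPositive : Prop :=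
  (0 : N) ≠ infty ∧ ∀ u : N, IsAddUnit u → u = 0

/-- `N` is integral: `a + b = ∞` with `a ≠ ∞` implies `b = ∞`. -/
def IsIntegral : Prop :=
  ∀ a b : N, a ≠ infty → a + b = infty → b = infty

/-- `N` is cancellative: `a + c = b + c ≠ ∞` implies `a = b`. -/
def IsCancellative : Prop :=
  ∀ a b c : N, a + c = b + c → a + c ≠ infty → a = b

/-- `N` is torsion-free: `n a = n b` with `n ≥ 1` implies `a = b`. -/
def IsTorsionFree : Prop :=
  ∀ (a b : N) (n : ℕ), 1 ≤ n → n • a = n • b → a = b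

/-- `N₊`, the set of all non-units of `N`. -/
def plus : Set N := {a | ¬ IsAddUnit a}

end Properties

section Ideals

/-- An ideal of a commutative binoid: a nonempty subset `I` with `I + N ⊆ I`. -/
@[ext]
structure Ideal (N : Type*) [Binoid N] where
  /-- the underlying set -/
  carrier : Set N
  nonempty : carrier.Nonempty
  add_mem : ∀ a ∈ carrier, ∀ b : N, a + b ∈ carrier

variable {N : Type*} [Binoid N]

instance : SetLike (Ideal N) N where
  coe I := I.carrier
  coe_injective _ _ h := Ideal.ext h

/-- Ideals are ordered by inclusion. -/
instance : PartialOrder (Ideal N) := PartialOrder.ofSetLike (Ideal N) N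

theorem Ideal.infty_mem (I : Ideal N) : infty ∈ I := by
  obtain ⟨a, ha⟩ := I.nonempty
  have h := I.add_mem a ha infty
  rwa [add_comm, infty_add] at h

/-- The ideal generated by a set `S`: it consists of `∞` and the elements of `S + N`. -/
def Ideal.span (S : Set N) : Ideal N where
  carrier := {x | x = infty ∨ ∃ s ∈ S, ∃ b : N, x = s + b}
  nonempty := ⟨infty, Or.inl rfl⟩
  add_mem := by
    rintro a (rfl | ⟨s, hs, c, rfl⟩) b
    · exact Or.inl (infty_add b)
    · exact Or.inr ⟨s, hs, c + b, add_assoc s c b⟩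

theorem Ideal.subset_span (S : Set N) : S ⊆ (Ideal.span S : Set N) :=
  fun s hs => Or.inr ⟨s, hs, 0, (add_zero s).symm⟩

/-- `Ideal.span S` is the smallest ideal that contains `S`. -/
theorem Ideal.span_le {S : Set N} {I : Ideal N} : Ideal.span S ≤ I ↔ S ⊆ (I : Set N) := by
  constructor
  · intro h s hs
    exact h (Ideal.subset_span S hs)
  · rintro h x (rfl | ⟨s, hs, c, rfl⟩)
    · exact I.infty_mem
    · exact I.add_mem s (h hs) c

/-- The radical of an ideal. -/
def Ideal.radical (I : Ideal N) : Set N := {a | ∃ n : ℕ, n • a ∈ I}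

/-- `𝔫` is an `N₊`-primary ideal if its radical is `N₊`. -/
def Ideal.IsPlusPrimary (I : Ideal N) : Prop := I.radical = plus N

/-- The Frobenius sum `[n]I`: the ideal generated by the elements `n a` with `a ∈ I`. -/
def Ideal.frobeniusSum (n : ℕ) (I : Ideal N) : Ideal N :=
  Ideal.span {x | ∃ a ∈ I, x = n • a}

/-- An ideal `𝔭 ≠ N` is prime if `a + b ∈ 𝔭` implies `a ∈ 𝔭` or `b ∈ 𝔭`. -/
def Ideal.IsPrime (I : Ideal N) : Prop :=
  (I : Set N) ≠ Set.univ ∧ ∀ a b : N, a + b ∈ I → a ∈ I ∨ b ∈ I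

/-- The Rees congruence of an ideal: `x ∼ y` if `x = y` or both lie in `I`. -/
def Ideal.reesCon (I : Ideal N) : AddCon N where
  r x y := x = y ∨ (x ∈ I ∧ y ∈ I)
  iseqv := by
    refine ⟨fun x => Or.inl rfl, ?_, ?_⟩
    · rintro x y (rfl | ⟨hx, hy⟩)
      · exact Or.inl rfl
      · exact Or.inr ⟨hy, hx⟩
    · rintro x y z (rfl | ⟨hx, hy⟩) (rfl | ⟨hy', hz⟩)
      · exact Or.inl rfl
      · exact Or.inr ⟨hy', hz⟩
      · exact Or.inr ⟨hx, hy⟩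
      · exact Or.inr ⟨hx, hz⟩
  add' := by
    rintro w x y z (rfl | ⟨hw, hx⟩) (rfl | ⟨hy, hz⟩)
    · exact Or.inl rfl
    · refine Or.inr ⟨?_, ?_⟩
      · rw [add_comm]; exact I.add_mem y hy w
      · rw [add_comm]; exact I.add_mem z hz w
    · exact Or.inr ⟨I.add_mem w hw y, I.add_mem x hx y⟩
    · exact Or.inr ⟨I.add_mem w hw y, I.add_mem x hx z⟩

/-- The quotient binoid `N/I`. -/
def Ideal.Quotient (I : Ideal N) : Type _ := I.reesCon.Quotient

instance (I : Ideal N) : Binoid I.Quotient :=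
  { (inferInstance : AddCommMonoid I.reesCon.Quotient) with
    infty := I.reesCon.mk' infty
    infty_add := by
      intro a
      induction a using AddCon.induction_on with
      | H x =>
        change I.reesCon.mk' infty + I.reesCon.mk' x = I.reesCon.mk' infty
        rw [← map_add, infty_add] }

end Ideals

section HilbertKunz

variable {N : Type*} [Binoid N]

/-- The combinatorial dimension: the supremum of the lengths of strictly increasing chains of
prime ideals. -/
noncomputable def dim (N : Type*) [Binoid N] : WithBot ℕ∞ :=
  Order.krullDim {p : Ideal N // p.IsPrime}

/-- The number `# S` of elements of `S` that are different from `∞`. -/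
noncomputable def bulletCard (S : Type*) [Binoid S] : ℕ :=
  Nat.card {x : S // x ≠ infty}

/-- The Hilbert-Kunz function `q ↦ # N/[q]𝔫`. -/
noncomputable def hkFunction (I : Ideal N) (q : ℕ) : ℕ :=
  bulletCard (I.frobeniusSum q).Quotient

/-- The Hilbert-Kunz multiplicity of `𝔫` on `N` exists and equals `e`: the dimension of `N` is a
natural number `d`, all `N/[q]𝔫` with `q ≥ 1` are finite, and `# N/[q]𝔫 / q ^ d` tends to `e`. -/
def HasHKMultiplicity (I : Ideal N) (e : ℝ) : Prop :=
  ∃ d : ℕ, dim N = d ∧ (∀ q : ℕ, 1 ≤ q → Finite (I.frobeniusSum q).Quotient) ∧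
    Tendsto (fun q : ℕ => (hkFunction I q : ℝ) / (q : ℝ) ^ d) atTop (𝓝 e)

end HilbertKunz

section Difference

variable (N : Type*) [Binoid N]

/-- The submonoid generated by `N^• = N ∖ {∞}`. -/
def bulletSubmonoid : AddSubmonoid N := AddSubmonoid.closure {a : N | a ≠ infty}

/-- The difference binoid `diff N`: the localization of `N` at the submonoid generated
by `N^•`. -/
def Diff : Type _ := AddLocalization (bulletSubmonoid N)

theorem mk_infty_add (x : AddLocalization (bulletSubmonoid N)) :
    AddLocalization.mk infty 0 + x = AddLocalization.mk infty 0 := by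
  induction x using AddLocalization.induction_on with
  | H y =>
    obtain ⟨a, s⟩ := y
    rw [AddLocalization.mk_add, AddLocalization.mk_eq_mk_iff, AddLocalization.r_iff_exists]
    have h : ∀ c : N, c + infty = infty := fun c => by rw [add_comm, infty_add]
    exact ⟨0, by simp [infty_add, h]⟩

noncomputable instance : Binoid (Diff N) :=
  { (inferInstance : AddCommMonoid (AddLocalization (bulletSubmonoid N))) with
    infty := (AddLocalization.mk infty 0 : AddLocalization (bulletSubmonoid N))
    infty_add := mk_infty_add N }

/-- The canonical homomorphism `N → diff N`. -/
noncomputable def toDiff : N →+ Diff N :=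
  (AddLocalization.addMonoidOf (bulletSubmonoid N)).toAddMonoidHom

/-- The normalization of `N`: all `x ∈ diff N` with `n x ∈ N` for some `n ≥ 1`. -/
def normalization : Set (Diff N) :=
  {x | ∃ n : ℕ, 1 ≤ n ∧ n • x ∈ Set.range (toDiff N)}

/-- `N` is normal: it agrees with its normalization inside `diff N`. -/
def IsNormal : Prop := Set.range (toDiff N) = normalization N

variable {N}

theorem isAddUnit_toDiff (a : {a : N // a ≠ infty}) : IsAddUnit (toDiff N a) :=
  (AddLocalization.addMonoidOf (bulletSubmonoid N)).map_addUnits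
    ⟨a, AddSubmonoid.subset_closure a.2⟩

/-- The image of an element of `N^•` in the difference group `(diff N)^×`. -/
noncomputable def toDiffUnits (a : {a : N // a ≠ infty}) : AddUnits (Diff N) :=
  (isAddUnit_toDiff a).addUnit

variable {d : ℕ}

/-- The point of `ℝ^d` given by an element of `N^•` under an identification of the difference
group with `ℤ^d`. -/
noncomputable def latticePoint (φ : AddUnits (Diff N) ≃+ (Fin d → ℤ))
    (a : {a : N // a ≠ infty}) : Fin d → ℝ :=
  fun i => (φ (toDiffUnits a) i : ℝ)

/-- The cone `C = ℝ₊ N^•` in `ℝ^d`. -/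
def cone (φ : AddUnits (Diff N) ≃+ (Fin d → ℤ)) : PointedCone ℝ (Fin d → ℝ) :=
  PointedCone.hull ℝ (Set.range (latticePoint φ))

/-- The region `B = C ∖ ⋃ (a + C)`, where `a` runs through the elements of `A ∖ {∞}`. -/
def region (φ : AddUnits (Diff N) ≃+ (Fin d → ℤ)) (A : Set N) : Set (Fin d → ℝ) :=
  (cone φ : Set (Fin d → ℝ)) \
    ⋃ a ∈ {a : {a : N // a ≠ infty} | (a : N) ∈ A},
      (fun x => latticePoint φ a + x) '' (cone φ : Set (Fin d → ℝ))

end Difference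

end Binoid

/-!
The identification of the difference group with `ℤᵈ` turns `N^•` into a finitely generated
submonoid `M ⊆ ℤᵈ` which generates `ℤᵈ` as a group, and normality means that `M` is saturated:
`n z ∈ M` with `n ≥ 1` implies `z ∈ M`. By Carathéodory's theorem the real cone `C` over `M` is
a finite union of simplicial cones over bases of `ℝᵈ` that consist of generators, and Cramer's rule
shows that a lattice point of `C` has a multiple in `M`. Hence `M = C ∩ ℤᵈ`
(`castVec_mem_realCone_iff`), so the elements of `N` outside of `[q]𝔫` are the lattice points of
the dilated region `q B` (`mem_latticeComplement_iff`, `Binoid.mem_frobeniusSum_iff`). By Dickson's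
lemma `B` is cut out by finitely many translates of `C`; as `C` is convex, the boundary of `B` is
a null set. The region is bounded because every generator of `M` other than `0` has a multiple
in `𝔫`. The theorem on lattice point counts of bounded Jordan measurable sets then gives the
convergence of `# N/[q]𝔫 / q ^ d` to the volume of `B`.

The volume is rational because the indicator function of `B` is piecewise polynomial with respect
to rational hyperplanes and rational coefficients, and integrating out one variable over a rational
interval preserves this class of functions (`piecewisePoly.exists_rat_integral_eq`).

For the dimension, a prime ideal is determined by its complement, a face of `N^•`. A face consists
of all elements of `N^•` in its rational span, so these spans shrink strictly along a chain of
primes, which bounds the length of the chain by `d`. Conversely, modulo the span of a face `F` the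
monoid `N^•` spans a pointed cone, and an extremal ray of it gives a face that contains `F` and has
a span of dimension at most one more (`Binoid.exists_isPrime_lt_finrank_le`), so that a chain of
length `d` exists.
-/

/-! ### Piecewise polynomial functions with rational coefficients -/

/-- The rational affine form `x ↦ ∑ cᵢ xᵢ + b` on `ℝⁿ`. -/
noncomputable def ratAffine {n : ℕ} (c : Fin n → ℚ) (b : ℚ) (x : Fin n → ℝ) : ℝ :=
  ∑ i, (c i : ℝ) * x i + b

open Classical in
/-- The indicator function of the closed half-space `0 ≤ ratAffine c b`. -/
noncomputable def halfSpaceInd {n : ℕ} (c : Fin n → ℚ) (b : ℚ) (x : Fin n → ℝ) : ℝ :=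
  if 0 ≤ ratAffine c b x then 1 else 0

/-- The `ℚ`-algebra of functions on `ℝⁿ` generated by the coordinates and the indicator functions
of rational half-spaces: the functions that are polynomial with rational coefficients on each
piece of some partition of `ℝⁿ` by rational hyperplanes. -/
noncomputable def piecewisePoly (n : ℕ) : Subalgebra ℚ ((Fin n → ℝ) → ℝ) :=
  Algebra.adjoin ℚ ({f | ∃ i, f = fun x => x i} ∪ {f | ∃ c b, f = halfSpaceInd c b})

namespace piecewisePoly

variable {n : ℕ}

theorem coord_mem (i : Fin n) : (fun x : Fin n → ℝ => x i) ∈ piecewisePoly n :=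
  Algebra.subset_adjoin (Or.inl ⟨i, rfl⟩)

theorem halfSpaceInd_mem (c : Fin n → ℚ) (b : ℚ) : halfSpaceInd c b ∈ piecewisePoly n :=
  Algebra.subset_adjoin (Or.inr ⟨c, b, rfl⟩)

theorem const_mem (r : ℚ) : (fun _ : Fin n → ℝ => (r : ℝ)) ∈ piecewisePoly n :=
  (piecewisePoly n).algebraMap_mem r

theorem ratAffine_mem (c : Fin n → ℚ) (b : ℚ) : ratAffine c b ∈ piecewisePoly n := by
  have h : ratAffine c b = ∑ i, (fun _ => (c i : ℝ)) * (fun x : Fin n → ℝ => x i) +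
      fun _ => (b : ℝ) := by
    ext x; simp [ratAffine]
  rw [h]
  exact add_mem (sum_mem fun i _ => mul_mem (const_mem _) (coord_mem i)) (const_mem b)

theorem ratAffine_sub (c c' : Fin n → ℚ) (b b' : ℚ) (x : Fin n → ℝ) :
    ratAffine (c - c') (b - b') x = ratAffine c b x - ratAffine c' b' x := by
  simp [ratAffine, sub_mul]; ring

theorem ratAffine_const (b : ℚ) (x : Fin n → ℝ) : ratAffine 0 b x = b := by simp [ratAffine]

theorem halfSpaceInd_sub (c c' : Fin n → ℚ) (b b' : ℚ) (x : Fin n → ℝ)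
    [Decidable (ratAffine c' b' x ≤ ratAffine c b x)] :
    halfSpaceInd (c - c') (b - b') x = if ratAffine c' b' x ≤ ratAffine c b x then 1 else 0 := by
  simp only [halfSpaceInd, ratAffine_sub, sub_nonneg]

theorem ratAffine_cons (c : Fin (n + 1) → ℚ) (b : ℚ) (t : ℝ) (x : Fin n → ℝ) :
    ratAffine c b (Fin.cons t x) = c 0 * t + ratAffine (Fin.tail c) b x := by
  simp [ratAffine, Fin.sum_univ_succ, Fin.tail, add_assoc]

theorem ratAffine_smul (r : ℚ) (c : Fin n → ℚ) (b : ℚ) (x : Fin n → ℝ) :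
    ratAffine (r • c) (r * b) x = r * ratAffine c b x := by
  simp [ratAffine, mul_add, Finset.mul_sum, mul_assoc]

/-- Truncation of a rational affine form to `[-M, M]` is piecewise polynomial. -/
theorem clamp_mem (c : Fin n → ℚ) (b : ℚ) (M : ℕ) :
    (fun x => max (-(M : ℝ)) (min (ratAffine c b x) M)) ∈ piecewisePoly n := by
  classical
  have h : (fun x => max (-(M : ℝ)) (min (ratAffine c b x) M)) =
      halfSpaceInd (0 - c) (-(M : ℚ) - b) * (fun _ => ((-(M : ℚ) : ℚ) : ℝ)) +
      (1 - halfSpaceInd (0 - c) (-(M : ℚ) - b)) *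
        (halfSpaceInd (c - 0) (b - (M : ℚ)) * (fun _ => ((M : ℚ) : ℝ)) +
          (1 - halfSpaceInd (c - 0) (b - (M : ℚ))) * ratAffine c b) := by
    ext x
    simp only [Pi.add_apply, Pi.mul_apply, Pi.sub_apply, Pi.one_apply, halfSpaceInd_sub,
      ratAffine_const]
    push_cast
    have hM : (0 : ℝ) ≤ M := Nat.cast_nonneg M
    split_ifs with h1 h2 h2
    · rw [min_eq_left (by linarith), max_eq_left h1]; ring
    · rw [min_eq_left (by linarith), max_eq_left h1]; ring
    · rw [min_eq_right h2, max_eq_right (by linarith)]; ring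
    · rw [min_eq_left (by linarith), max_eq_right (by linarith)]; ring
  rw [h]
  have h1 : (1 : (Fin n → ℝ) → ℝ) ∈ piecewisePoly n := one_mem _
  exact add_mem (mul_mem (halfSpaceInd_mem _ _) (const_mem _)) (mul_mem
    (sub_mem h1 (halfSpaceInd_mem _ _)) (add_mem (mul_mem (halfSpaceInd_mem _ _) (const_mem _))
    (mul_mem (sub_mem h1 (halfSpaceInd_mem _ _)) (ratAffine_mem _ _))))

/-- A monomial in the integration variable `t`, cut off above at a rational affine form in the
remaining variables `x`, with a piecewise polynomial coefficient. -/
noncomputable def cutMonomial (g : (Fin n → ℝ) → ℝ) (k : ℕ) (c : Fin n → ℚ) (b : ℚ) :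
    (Fin n → ℝ) → ℝ → ℝ :=
  open Classical in fun x t => g x * t ^ k * if t ≤ ratAffine c b x then 1 else 0

/-- The `ℚ`-span of the cut-off monomials. -/
noncomputable def cutSpan (n : ℕ) : Submodule ℚ ((Fin n → ℝ) → ℝ → ℝ) :=
  Submodule.span ℚ {F | ∃ g ∈ piecewisePoly n, ∃ k c b, F = cutMonomial g k c b}

theorem cutMonomial_mem {g : (Fin n → ℝ) → ℝ} (hg : g ∈ piecewisePoly n) (k : ℕ) (c : Fin n → ℚ)
    (b : ℚ) : cutMonomial g k c b ∈ cutSpan n :=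
  Submodule.subset_span ⟨g, hg, k, c, b, rfl⟩

/-- Products of cut-off monomials reduce to cut-off monomials, since of two upper bounds for `t`
only the smaller one matters, and which one is smaller is decided by a rational half-space. -/
theorem cutSpan_mul_mem {F G : (Fin n → ℝ) → ℝ → ℝ} (hF : F ∈ cutSpan n) (hG : G ∈ cutSpan n) :
    F * G ∈ cutSpan n := by
  classical
  suffices h : cutSpan n * cutSpan n ≤ cutSpan n from h (Submodule.mul_mem_mul hF hG)
  conv_lhs => rw [cutSpan, Submodule.span_mul_span]
  rw [Submodule.span_le]
  rintro _ ⟨_, ⟨g, hg, k, c, b, rfl⟩, _, ⟨g', hg', k', c', b', rfl⟩, rfl⟩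
  have h : cutMonomial g k c b * cutMonomial g' k' c' b' =
      cutMonomial (g * g' * halfSpaceInd (c' - c) (b' - b)) (k + k') c b +
      cutMonomial (g * g' * (1 - halfSpaceInd (c' - c) (b' - b))) (k + k') c' b' := by
    ext x t
    simp only [Pi.add_apply, Pi.mul_apply, Pi.sub_apply, Pi.one_apply, cutMonomial,
      halfSpaceInd_sub]
    by_cases h1 : ratAffine c b x ≤ ratAffine c' b' x
    · by_cases h2 : t ≤ ratAffine c b x
      · simp [h1, h2, h2.trans h1]; ring
      · simp [h1, h2]
    · by_cases h2 : t ≤ ratAffine c' b' x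
      · have : t ≤ ratAffine c b x := h2.trans (not_le.mp h1).le
        simp [h1, h2, this]; ring
      · simp [h1, h2]
  change cutMonomial g k c b * cutMonomial g' k' c' b' ∈ cutSpan n
  rw [h]
  have h1 : (1 : (Fin n → ℝ) → ℝ) ∈ piecewisePoly n := one_mem _
  exact add_mem (cutMonomial_mem (mul_mem (mul_mem hg hg') (halfSpaceInd_mem _ _)) _ _ _)
    (cutMonomial_mem (mul_mem (mul_mem hg hg') (sub_mem h1 (halfSpaceInd_mem _ _))) _ _ _)

/-- Lebesgue measure on the interval `[-M, M]`. -/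
noncomputable abbrev intervalMeasure (M : ℕ) : Measure ℝ := volume.restrict (Set.Icc (-(M : ℝ)) M)

/-- As a function of one distinguished variable `t ∈ [-M, M]`, a piecewise polynomial is a
combination of cut-off monomials, up to finitely many `t` for each value of the others. -/
theorem exists_cutSpan_ae_eq (M : ℕ) {f : (Fin (n + 1) → ℝ) → ℝ} (hf : f ∈ piecewisePoly (n + 1)) :
    ∃ F ∈ cutSpan n, ∀ x, ∀ᵐ t ∂intervalMeasure M, f (Fin.cons t x) = F x t := by
  classical
  have hM : ∀ᵐ t : ℝ ∂intervalMeasure M, t ≤ M :=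
    (ae_restrict_mem measurableSet_Icc).mono fun t ht => ht.2
  -- a piecewise polynomial times a power of `t`, without a cut-off, is cut off at `t ≤ M`
  have hfree : ∀ g ∈ piecewisePoly n, ∀ k : ℕ, ∃ F ∈ cutSpan n, ∀ x, ∀ᵐ t ∂intervalMeasure M,
      g x * t ^ k = F x t := fun g hg k =>
    ⟨cutMonomial g k 0 M, cutMonomial_mem hg _ _ _, fun x => hM.mono fun t ht => by
      simp [cutMonomial, ratAffine_const, ht]⟩
  induction hf using Algebra.adjoin_induction with
  | mem f hf =>
    rcases hf with ⟨i, rfl⟩ | ⟨c, b, rfl⟩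
    · refine Fin.cases ?_ (fun j => ?_) i
      · simpa using hfree 1 (one_mem _) 1
      · simpa using hfree _ (coord_mem j) 0
    · rcases lt_trichotomy (c 0) 0 with h0 | h0 | h0
      · refine ⟨cutMonomial 1 0 ((-(c 0)⁻¹) • Fin.tail c) (-(c 0)⁻¹ * b),
          cutMonomial_mem (one_mem _) _ _ _, fun x => .of_forall fun t => ?_⟩
        have h0' : (c 0 : ℝ) < 0 := by exact_mod_cast h0
        simp only [halfSpaceInd, cutMonomial, ratAffine_cons, ratAffine_smul, Pi.one_apply,
          pow_zero, one_mul]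
        congr 1
        rw [eq_iff_iff]
        push_cast
        rw [neg_mul, ← div_eq_inv_mul, ← neg_div, ← neg_div_neg_eq, neg_neg,
          le_div_iff₀ (by linarith)]
        constructor <;> intro h <;> linarith
      · obtain ⟨F, hF, h⟩ := hfree _ (halfSpaceInd_mem (Fin.tail c) b) 0
        refine ⟨F, hF, fun x => (h x).mono fun t ht => ?_⟩
        rw [← ht]
        simp [halfSpaceInd, ratAffine_cons, h0]
      · obtain ⟨F, hF, h⟩ := hfree 1 (one_mem _) 0
        refine ⟨F - cutMonomial 1 0 ((-(c 0)⁻¹) • Fin.tail c) (-(c 0)⁻¹ * b),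
          sub_mem hF (cutMonomial_mem (one_mem _) _ _ _), fun x => ?_⟩
        -- a lower bound for `t` is the negation of an upper bound, up to the case of equality
        have hne : ∀ᵐ t ∂intervalMeasure M,
            t ≠ ratAffine ((-(c 0)⁻¹) • Fin.tail c) (-(c 0)⁻¹ * b) x :=
          ae_restrict_of_ae (by simp [ae_iff])
        filter_upwards [h x, hne] with t ht hne
        have h0' : (0 : ℝ) < c 0 := by exact_mod_cast h0
        rw [Pi.sub_apply, Pi.sub_apply, ← ht]
        simp only [halfSpaceInd, cutMonomial, ratAffine_cons, ratAffine_smul, Pi.one_apply,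
          pow_zero, one_mul] at hne ⊢
        push_cast at hne ⊢
        have key : 0 ≤ (c 0 : ℝ) * t + ratAffine (Fin.tail c) b x ↔
            ¬ t ≤ -(c 0 : ℝ)⁻¹ * ratAffine (Fin.tail c) b x := by
          rw [not_le, ← hne.symm.le_iff_lt, neg_mul, ← div_eq_inv_mul, ← neg_div,
            div_le_iff₀ h0']
          constructor <;> intro h <;> linarith
        by_cases h3 : t ≤ -(c 0 : ℝ)⁻¹ * ratAffine (Fin.tail c) b x
        · rw [if_neg (by rw [key]; exact not_not.mpr h3), if_pos h3]; ring
        · rw [if_pos (key.mpr h3), if_neg h3]; ring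
  | algebraMap r => simpa using hfree _ (const_mem r) 0
  | add f g _ _ hf hg =>
    obtain ⟨F, hF, hf⟩ := hf
    obtain ⟨G, hG, hg⟩ := hg
    refine ⟨F + G, add_mem hF hG, fun x => ?_⟩
    filter_upwards [hf x, hg x] with t h1 h2
    simp [h1, h2]
  | mul f g _ _ hf hg =>
    obtain ⟨F, hF, hf⟩ := hf
    obtain ⟨G, hG, hg⟩ := hg
    refine ⟨F * G, cutSpan_mul_mem hF hG, fun x => ?_⟩
    filter_upwards [hf x, hg x] with t h1 h2
    simp [h1, h2]

theorem integral_cutMonomial (M : ℕ) (g : (Fin n → ℝ) → ℝ) (k : ℕ) (c : Fin n → ℚ) (b : ℚ)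
    (x : Fin n → ℝ) : ∫ t, cutMonomial g k c b x t ∂intervalMeasure M =
      g x * (((max (-(M : ℝ)) (min (ratAffine c b x) M)) ^ (k + 1) - (-(M : ℝ)) ^ (k + 1)) /
        (k + 1)) := by
  classical
  have hM : (0 : ℝ) ≤ M := Nat.cast_nonneg M
  set l := ratAffine c b x with hl
  have h1 : ∀ t : ℝ, cutMonomial g k c b x t = g x * (Set.Iic l).indicator (fun t => t ^ k) t := by
    intro t
    simp [cutMonomial, Set.indicator_apply, ← hl]
  simp_rw [h1]
  rw [integral_const_mul, integral_indicator measurableSet_Iic,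
    Measure.restrict_restrict measurableSet_Iic]
  congr 1
  have h2 : Set.Iic l ∩ Set.Icc (-(M : ℝ)) M = Set.Icc (-(M : ℝ)) (min l M) := by
    ext t; simp only [Set.mem_inter_iff, Set.mem_Iic, Set.mem_Icc, le_min_iff]; tauto
  rw [h2]
  rcases le_total (-(M : ℝ)) (min l M) with h3 | h3
  · rw [max_eq_right h3, integral_Icc_eq_integral_Ioc, ← intervalIntegral.integral_of_le h3,
      integral_pow]
  · have h4 : volume (Set.Icc (-(M : ℝ)) (min l M)) = 0 := by
      rw [Real.volume_Icc, ENNReal.ofReal_eq_zero]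
      linarith
    rw [max_eq_left h3, Measure.restrict_eq_zero.mpr h4]
    simp

theorem cutSpan_integral (M : ℕ) {F : (Fin n → ℝ) → ℝ → ℝ} (hF : F ∈ cutSpan n) :
    (∀ x, Integrable (F x) (intervalMeasure M)) ∧
      (fun x => ∫ t, F x t ∂intervalMeasure M) ∈ piecewisePoly n := by
  classical
  induction hF using Submodule.span_induction with
  | mem F hF =>
    obtain ⟨g, hg, k, c, b, rfl⟩ := hF
    constructor
    · intro x
      have h1 : cutMonomial g k c b x =
          (Set.Iic (ratAffine c b x)).indicator (fun t => g x * t ^ k) := by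
        ext t
        simp [cutMonomial, Set.indicator_apply]
      rw [h1]
      refine Integrable.indicator ?_ measurableSet_Iic
      exact (Continuous.continuousOn (by fun_prop)).integrableOn_compact isCompact_Icc
    · simp_rw [integral_cutMonomial]
      have h : (fun x => g x * (((max (-(M : ℝ)) (min (ratAffine c b x) M)) ^ (k + 1) -
          (-(M : ℝ)) ^ (k + 1)) / (k + 1))) =
          g * (((fun x => max (-(M : ℝ)) (min (ratAffine c b x) M)) ^ (k + 1) -
            (fun _ => (((-(M : ℚ)) ^ (k + 1) : ℚ) : ℝ))) * fun _ => (((k + 1 : ℚ)⁻¹ : ℚ) : ℝ)) := by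
        ext x
        simp only [Pi.mul_apply, Pi.sub_apply, Pi.pow_apply]
        push_cast
        rw [div_eq_mul_inv]
      rw [h]
      exact mul_mem hg (mul_mem (sub_mem (pow_mem (clamp_mem c b M) _) (const_mem _)) (const_mem _))
  | zero =>
    refine ⟨fun x => by simp, ?_⟩
    simpa using const_mem (n := n) 0
  | add F G _ _ hF hG =>
    refine ⟨fun x => (hF.1 x).add (hG.1 x), ?_⟩
    have h : (fun x => ∫ t, (F + G) x t ∂intervalMeasure M) =
        (fun x => ∫ t, F x t ∂intervalMeasure M) + fun x => ∫ t, G x t ∂intervalMeasure M := by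
      ext x
      exact integral_add (hF.1 x) (hG.1 x)
    rw [h]
    exact add_mem hF.2 hG.2
  | smul r F _ hF =>
    refine ⟨fun x => (hF.1 x).smul r, ?_⟩
    have h : (fun x => ∫ t, (r • F) x t ∂intervalMeasure M) =
        r • fun x => ∫ t, F x t ∂intervalMeasure M := by
      ext x
      exact integral_smul r (F x)
    rw [h]
    exact Subalgebra.smul_mem _ hF.2 r

theorem measurable {f : (Fin n → ℝ) → ℝ} (hf : f ∈ piecewisePoly n) : Measurable f := by
  induction hf using Algebra.adjoin_induction with
  | mem f hf =>
    rcases hf with ⟨i, rfl⟩ | ⟨c, b, rfl⟩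
    · exact measurable_pi_apply i
    · refine Measurable.ite (measurableSet_le measurable_const ?_) measurable_const measurable_const
      unfold ratAffine
      fun_prop
  | algebraMap r => exact measurable_const
  | add f g _ _ hf hg => exact hf.add hg
  | mul f g _ _ hf hg => exact hf.mul hg

theorem exists_bound (M : ℕ) {f : (Fin n → ℝ) → ℝ} (hf : f ∈ piecewisePoly n) :
    ∃ K : ℝ, ∀ x ∈ Set.univ.pi fun _ => Set.Icc (-(M : ℝ)) M, |f x| ≤ K := by
  induction hf using Algebra.adjoin_induction with
  | mem f hf =>
    rcases hf with ⟨i, rfl⟩ | ⟨c, b, rfl⟩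
    · exact ⟨M, fun x hx => abs_le.mpr (hx i trivial)⟩
    · refine ⟨1, fun x _ => ?_⟩
      unfold halfSpaceInd
      split_ifs <;> simp
  | algebraMap r => exact ⟨|(r : ℝ)|, fun x _ => le_rfl⟩
  | add f g _ _ hf hg =>
    obtain ⟨K, hK⟩ := hf
    obtain ⟨K', hK'⟩ := hg
    exact ⟨K + K', fun x hx => (abs_add_le _ _).trans (add_le_add (hK x hx) (hK' x hx))⟩
  | mul f g _ _ hf hg =>
    obtain ⟨K, hK⟩ := hf
    obtain ⟨K', hK'⟩ := hg
    refine ⟨K * K', fun x hx => ?_⟩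
    rw [Pi.mul_apply, abs_mul]
    exact mul_le_mul (hK x hx) (hK' x hx) (abs_nonneg _) ((abs_nonneg _).trans (hK x hx))

theorem integrable (M : ℕ) {f : (Fin n → ℝ) → ℝ} (hf : f ∈ piecewisePoly n) :
    Integrable f (Measure.pi fun _ : Fin n => intervalMeasure M) := by
  obtain ⟨K, hK⟩ := exists_bound M hf
  refine Integrable.of_bound (measurable hf).aestronglyMeasurable K ?_
  rw [← Measure.restrict_pi_pi]
  exact (ae_restrict_mem (MeasurableSet.univ_pi fun _ => measurableSet_Icc)).mono hK

/-- The integral of a piecewise polynomial over the box `[-M, M]ⁿ` is rational: each integration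
over one variable leaves a piecewise polynomial in the others. -/
theorem exists_rat_integral_eq (M : ℕ) : ∀ {n : ℕ} {f : (Fin n → ℝ) → ℝ}, f ∈ piecewisePoly n →
    ∃ e : ℚ, ∫ x, f x ∂(Measure.pi fun _ : Fin n => intervalMeasure M) = e := by
  intro n
  induction n with
  | zero =>
    intro f hf
    have h : ∃ e : ℚ, f = fun _ => (e : ℝ) := by
      induction hf using Algebra.adjoin_induction with
      | mem f hf =>
        rcases hf with ⟨i, rfl⟩ | ⟨c, b, rfl⟩
        · exact i.elim0
        · by_cases h : 0 ≤ b
          · exact ⟨1, by ext x; simp [halfSpaceInd, ratAffine, h]⟩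
          · exact ⟨0, by ext x; simp [halfSpaceInd, ratAffine, h]⟩
      | algebraMap r => exact ⟨r, rfl⟩
      | add f g _ _ hf hg =>
        obtain ⟨e, rfl⟩ := hf
        obtain ⟨e', rfl⟩ := hg
        exact ⟨e + e', by ext; simp⟩
      | mul f g _ _ hf hg =>
        obtain ⟨e, rfl⟩ := hf
        obtain ⟨e', rfl⟩ := hg
        exact ⟨e * e', by ext; simp⟩
    obtain ⟨e, rfl⟩ := h
    refine ⟨e, ?_⟩
    rw [Measure.pi_of_empty]
    simp
  | succ n ih =>
    intro f hf
    obtain ⟨F, hF, hfF⟩ := exists_cutSpan_ae_eq M hf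
    obtain ⟨e, he⟩ := ih (cutSpan_integral M hF).2
    refine ⟨e, ?_⟩
    rw [← he]
    have hmp := (measurePreserving_piFinSuccAbove
      (fun _ : Fin (n + 1) => intervalMeasure M) 0).symm
    have hcons : ∀ p : ℝ × (Fin n → ℝ), (MeasurableEquiv.piFinSuccAbove
        (fun _ : Fin (n + 1) => ℝ) 0).symm p = Fin.cons p.1 p.2 := fun p => by
      simp [MeasurableEquiv.piFinSuccAbove, Fin.insertNthEquiv]
    rw [← hmp.integral_comp' f]
    have hint := (hmp.integrable_comp_emb (MeasurableEquiv.measurableEmbedding _)).mpr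
      (integrable M hf)
    refine (integral_prod_symm _ hint).trans ?_
    refine integral_congr_ae (.of_forall fun x => integral_congr_ae ?_)
    filter_upwards [hfF x] with t ht
    rw [Function.comp_apply, hcons, ht]

theorem measurableSet_of_indicator_mem {s : Set (Fin n → ℝ)}
    (hs : s.indicator 1 ∈ piecewisePoly n) : MeasurableSet s := by
  have h : s = s.indicator (1 : (Fin n → ℝ) → ℝ) ⁻¹' {1} := by
    ext x
    by_cases hx : x ∈ s <;> simp [hx]
  rw [h]
  exact measurable hs (measurableSet_singleton 1)

/-- A bounded set whose indicator function is piecewise polynomial has rational volume. -/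
theorem exists_rat_volume_eq {s : Set (Fin n → ℝ)} (hs : s.indicator 1 ∈ piecewisePoly n)
    (hb : Bornology.IsBounded s) : ∃ e : ℚ, volume.real s = e := by
  have hms := measurableSet_of_indicator_mem hs
  obtain ⟨R, hR⟩ := hb.subset_closedBall 0
  obtain ⟨M, hM⟩ := exists_nat_ge R
  have hsub : s ⊆ Set.univ.pi fun _ => Set.Icc (-(M : ℝ)) M := by
    intro x hx i _
    have h1 : ‖x‖ ≤ M := (mem_closedBall_zero_iff.mp (hR hx)).trans hM
    exact abs_le.mp ((norm_le_pi_norm x i).trans h1)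
  obtain ⟨e, he⟩ := exists_rat_integral_eq M hs
  refine ⟨e, ?_⟩
  rw [← Measure.restrict_pi_pi, integral_indicator_one hms, measureReal_restrict_apply hms,
    Set.inter_eq_left.mpr hsub] at he
  exact he

end piecewisePoly

/-! ### Finitely generated cones -/

section Cones

variable {K E : Type*} [Field K] [LinearOrder K] [IsStrictOrderedRing K] [AddCommGroup E]
  [Module K E]

theorem PointedCone.mem_hull_finset {S : Finset E} {x : E} :
    x ∈ PointedCone.hull K (S : Set E) ↔
      ∃ f : E → K, (∀ s ∈ S, 0 ≤ f s) ∧ ∑ s ∈ S, f s • s = x := by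
  constructor
  · intro h
    obtain ⟨f, -, hf⟩ := Submodule.mem_span_finset.mp h
    exact ⟨fun s => f s, fun s _ => (f s).2, hf⟩
  · rintro ⟨f, hf, rfl⟩
    exact sum_mem fun s hs => PointedCone.smul_mem _ (hf s hs) (PointedCone.subset_hull hs)

/-- One step of Carathéodory's argument: a linear relation among the generators allows one to
decrease the coefficients of a conic combination until one of them vanishes. -/
theorem PointedCone.exists_mem_hull_erase [DecidableEq E] {S : Finset E}
    (hS : ¬ LinearIndepOn K id (S : Set E)) {x : E} (hx : x ∈ PointedCone.hull K (S : Set E)) :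
    ∃ s ∈ S, x ∈ PointedCone.hull K ((S.erase s : Finset E) : Set E) := by
  obtain ⟨f, hf, rfl⟩ := PointedCone.mem_hull_finset.mp hx
  obtain ⟨g, hg, s₀, hs₀, hpos⟩ : ∃ g : E → K, ∑ s ∈ S, g s • s = 0 ∧ ∃ s ∈ S, 0 < g s := by
    rw [linearIndepOn_finset_iff] at hS
    push Not at hS
    obtain ⟨g, hg, s, hs, hne⟩ := hS
    rcases hne.lt_or_gt with h | h
    · refine ⟨-g, ?_, s, hs, neg_pos.mpr h⟩
      simpa using hg
    · exact ⟨g, hg, s, hs, h⟩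
  obtain ⟨i, hi, hmin⟩ := Finset.exists_min_image (S.filter fun s => 0 < g s) (fun s => f s / g s)
    ⟨s₀, Finset.mem_filter.mpr ⟨hs₀, hpos⟩⟩
  obtain ⟨hiS, hgi⟩ := Finset.mem_filter.mp hi
  refine ⟨i, hiS, PointedCone.mem_hull_finset.mpr ⟨fun s => f s - f i / g i * g s, ?_, ?_⟩⟩
  · intro s hs
    have hs' := Finset.mem_of_mem_erase hs
    rw [sub_nonneg]
    rcases lt_or_ge 0 (g s) with h | h
    · exact (le_div_iff₀ h).mp (hmin s (Finset.mem_filter.mpr ⟨hs', h⟩))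
    · exact (mul_nonpos_of_nonneg_of_nonpos (div_nonneg (hf i hiS) hgi.le) h).trans (hf s hs')
  · have h0 : (f i - f i / g i * g i) • i = 0 := by
      rw [div_mul_cancel₀ _ hgi.ne', sub_self, zero_smul]
    beta_reduce
    rw [Finset.sum_erase S (f := fun s => (f s - f i / g i * g s) • s) h0]
    simp_rw [sub_smul, mul_smul]
    rw [Finset.sum_sub_distrib, ← Finset.smul_sum, hg, smul_zero, sub_zero]

/-- Carathéodory's theorem for cones. -/
theorem PointedCone.exists_linearIndepOn_mem_hull (S : Finset E) {x : E}
    (hx : x ∈ PointedCone.hull K (S : Set E)) :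
    ∃ T ⊆ S, LinearIndepOn K id (T : Set E) ∧ x ∈ PointedCone.hull K (T : Set E) := by
  classical
  induction S using Finset.strongInduction with
  | H S ih =>
    by_cases hS : LinearIndepOn K id (S : Set E)
    · exact ⟨S, subset_rfl, hS, hx⟩
    · obtain ⟨s, hs, h⟩ := PointedCone.exists_mem_hull_erase hS hx
      obtain ⟨T, hT, h⟩ := ih _ (Finset.erase_ssubset hs) h
      exact ⟨T, hT.trans (Finset.erase_subset _ _), h⟩

/-- If the generators span the space, then each point of the cone lies in the cone over
a basis that consists of generators. -/
theorem PointedCone.exists_basis_of_mem_hull {d : ℕ} {S : Finset (Fin d → K)}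
    (hS : Submodule.span K (S : Set (Fin d → K)) = ⊤) {x : Fin d → K}
    (hx : x ∈ PointedCone.hull K (S : Set (Fin d → K))) :
    ∃ b : Fin d → Fin d → K, (∀ i, b i ∈ S) ∧ LinearIndependent K b ∧
      ∃ r : Fin d → K, (∀ i, 0 ≤ r i) ∧ ∑ i, r i • b i = x := by
  obtain ⟨T, hTS, hT, hx⟩ := PointedCone.exists_linearIndepOn_mem_hull S hx
  set T' := hT.extend (Finset.coe_subset.mpr hTS) with hT'
  have hind : LinearIndepOn K id T' := hT.linearIndepOn_extend _
  have hspan : Submodule.span K T' = ⊤ := by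
    rw [hT', hT.span_extend_eq_span, hS]
  have hsub : T' ⊆ S := hT.extend_subset _
  let B : Module.Basis T' K (Fin d → K) := Module.Basis.mk hind (by
    simp only [id_eq, Subtype.range_coe_subtype, Set.ofPred_mem_eq, hspan, le_refl])
  let e : T' ≃ Fin d := B.indexEquiv (Pi.basisFun K (Fin d))
  have hB : ∀ t, B t = t := fun t => by simp [B]
  refine ⟨fun i => e.symm i, fun i => hsub (e.symm i).2, ?_, ?_⟩
  · exact hind.comp e.symm e.symm.injective
  · have hx' : x ∈ PointedCone.hull K T' :=
      Submodule.span_mono (hT.subset_extend _) hx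
    have hr : ∀ y ∈ PointedCone.hull K T', ∀ t, 0 ≤ B.repr y t := by
      intro y hy
      induction hy using Submodule.span_induction with
      | mem y hy =>
        intro t
        have : B.repr y = Finsupp.single ⟨y, hy⟩ 1 := by
          rw [← B.repr_self, hB]
        rw [this, Finsupp.single_apply]
        split_ifs <;> simp
      | zero => simp
      | add y z _ _ hy hz =>
        intro t
        simpa using add_nonneg (hy t) (hz t)
      | smul a y _ hy =>
        intro t
        have : B.repr (a • y) t = (a : K) * B.repr y t := by
          have h : a • y = (a : K) • y := rfl
          rw [h, map_smul, Finsupp.smul_apply, smul_eq_mul]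
        rw [this]
        exact mul_nonneg a.2 (hy t)
    refine ⟨fun i => B.repr x (e.symm i), fun i => hr x hx' _, ?_⟩
    have hB' := B.sum_repr x
    let : Fintype T' := Fintype.ofEquiv _ e.symm
    have h1 : ∑ i, B.repr x (e.symm i) • ((e.symm i : T') : Fin d → K) =
        ∑ t : T', B.repr x t • (t : Fin d → K) :=
      e.symm.sum_comp fun t => B.repr x t • (t : Fin d → K)
    rw [h1]
    conv_rhs => rw [← B.sum_repr x]
    exact Finset.sum_congr rfl fun t _ => by rw [hB]

end Cones

/-! ### Rational regions -/

namespace piecewisePoly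

variable {n : ℕ}

theorem indicator_compl_mem {s : Set (Fin n → ℝ)} (hs : s.indicator 1 ∈ piecewisePoly n) :
    sᶜ.indicator 1 ∈ piecewisePoly n := by
  have h : sᶜ.indicator (1 : (Fin n → ℝ) → ℝ) = 1 - s.indicator 1 := by
    rw [Set.indicator_compl]
  rw [h]
  exact sub_mem (one_mem _) hs

theorem indicator_inter_mem {s t : Set (Fin n → ℝ)} (hs : s.indicator 1 ∈ piecewisePoly n)
    (ht : t.indicator 1 ∈ piecewisePoly n) : (s ∩ t).indicator 1 ∈ piecewisePoly n := by
  rw [Set.inter_indicator_one]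
  exact mul_mem hs ht

theorem indicator_biInter_mem {ι : Type*} (T : Finset ι) {s : ι → Set (Fin n → ℝ)}
    (hs : ∀ i ∈ T, (s i).indicator 1 ∈ piecewisePoly n) :
    (⋂ i ∈ T, s i).indicator 1 ∈ piecewisePoly n := by
  classical
  induction T using Finset.induction_on with
  | empty => simp [one_mem]
  | insert i T _ ih =>
    rw [Finset.set_biInter_insert]
    exact indicator_inter_mem (hs i (Finset.mem_insert_self i T))
      (ih fun j hj => hs j (Finset.mem_insert_of_mem hj))

theorem indicator_biUnion_mem {ι : Type*} (T : Finset ι) {s : ι → Set (Fin n → ℝ)}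
    (hs : ∀ i ∈ T, (s i).indicator 1 ∈ piecewisePoly n) :
    (⋃ i ∈ T, s i).indicator 1 ∈ piecewisePoly n := by
  have h : (⋃ i ∈ T, s i) = (⋂ i ∈ T, (s i)ᶜ)ᶜ := by simp
  rw [h]
  exact indicator_compl_mem (indicator_biInter_mem T fun i hi => indicator_compl_mem (hs i hi))

theorem indicator_halfSpace_mem (c : Fin n → ℚ) (b : ℚ) :
    {x | 0 ≤ ratAffine c b x}.indicator 1 ∈ piecewisePoly n := by
  convert halfSpaceInd_mem c b using 1
  ext x
  simp [halfSpaceInd, Set.indicator_apply]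

theorem comp_sub_mem {f : (Fin n → ℝ) → ℝ} (hf : f ∈ piecewisePoly n) (a : Fin n → ℚ) :
    (fun x => f (fun i => x i - a i)) ∈ piecewisePoly n := by
  induction hf using Algebra.adjoin_induction with
  | mem f hf =>
    rcases hf with ⟨i, rfl⟩ | ⟨c, b, rfl⟩
    · exact sub_mem (coord_mem i) (const_mem (a i))
    · convert halfSpaceInd_mem c (b - ∑ i, c i * a i) using 1
      ext x
      have : ratAffine c b (fun i => x i - a i) = ratAffine c (b - ∑ i, c i * a i) x := by
        simp [ratAffine, mul_sub, Finset.sum_sub_distrib]; ring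
      rw [halfSpaceInd, halfSpaceInd, this]
  | algebraMap r => exact const_mem r
  | add f g _ _ hf hg => exact add_mem hf hg
  | mul f g _ _ hf hg => exact mul_mem hf hg

end piecewisePoly

/-! ### Cones over integral vectors -/

/-- The entrywise cast of integral vectors to vectors over `K`. -/
def castVec (K : Type*) [Ring K] (d : ℕ) : (Fin d → ℤ) →+ (Fin d → K) :=
  (Int.castAddHom K).compLeft (Fin d)

section IntegralCone

variable {d : ℕ}

@[simp] theorem castVec_apply (K : Type*) [Ring K] (z : Fin d → ℤ) (i : Fin d) :
    castVec K d z i = z i := rfl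

theorem castVec_injective (K : Type*) [Ring K] [CharZero K] :
    Function.Injective (castVec K d) := fun x y h => by
  ext i
  exact Int.cast_injective (α := K) (congrFun h i)

/-- The real cone spanned by a set of integral vectors. -/
noncomputable def realCone (S : Set (Fin d → ℤ)) : PointedCone ℝ (Fin d → ℝ) :=
  PointedCone.hull ℝ (castVec ℝ d '' S)

theorem castVec_mem_realCone {S : Set (Fin d → ℤ)} {z : Fin d → ℤ}
    (hz : z ∈ AddSubmonoid.closure S) : castVec ℝ d z ∈ realCone S := by
  induction hz using AddSubmonoid.closure_induction with
  | mem z hz => exact PointedCone.subset_hull ⟨z, hz, rfl⟩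
  | zero => simp
  | add x y _ _ hx hy => rw [map_add]; exact add_mem hx hy

theorem realCone_closure (S : Set (Fin d → ℤ)) :
    realCone (AddSubmonoid.closure S : Set (Fin d → ℤ)) = realCone S := by
  apply le_antisymm
  · refine Submodule.span_le.mpr ?_
    rintro _ ⟨z, hz, rfl⟩
    exact castVec_mem_realCone hz
  · exact Submodule.span_mono (Set.image_mono AddSubmonoid.subset_closure)

/-- The simplicial cone over a basis `b` of integral vectors, given by the inequalities which
Cramer's rule yields for the coordinates with respect to `b`. -/
def simplicialCone (b : Fin d → Fin d → ℤ) : Set (Fin d → ℝ) :=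
  {x | ∀ i, 0 ≤ ∑ j, (((Matrix.of b).det * (Matrix.of b).adjugate j i : ℤ) : ℝ) * x j}

theorem castVec_sum_smul_eq_vecMul (b : Fin d → Fin d → ℤ) (r : Fin d → ℝ) :
    ∑ i, r i • castVec ℝ d (b i) = Matrix.vecMul r ((Matrix.of b).map (Int.castRingHom ℝ)) := by
  rw [Matrix.vecMul_eq_sum]
  rfl

theorem mem_simplicialCone_iff {b : Fin d → Fin d → ℤ} (hb : (Matrix.of b).det ≠ 0)
    {x : Fin d → ℝ} : x ∈ simplicialCone b ↔
      ∃ r : Fin d → ℝ, (∀ i, 0 ≤ r i) ∧ ∑ i, r i • castVec ℝ d (b i) = x := by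
  set D := (Matrix.of b).det with hD
  set A := (Matrix.of b).map (Int.castRingHom ℝ) with hA
  have hD' : (D : ℝ) ≠ 0 := by exact_mod_cast hb
  have hdet : A.det = D := by
    rw [hA, hD, ← RingHom.mapMatrix_apply, ← RingHom.map_det]; rfl
  have hadj : A.adjugate = (Matrix.of b).adjugate.map (Int.castRingHom ℝ) := by
    rw [hA, ← RingHom.mapMatrix_apply, ← RingHom.map_adjugate]; rfl
  have hmem : ∀ y, y ∈ simplicialCone b ↔ ∀ i, 0 ≤ (D : ℝ) * (Matrix.vecMul y A.adjugate) i := by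
    intro y
    refine forall_congr' fun i => ?_
    have : ∑ j, ((D * (Matrix.of b).adjugate j i : ℤ) : ℝ) * y j =
        (D : ℝ) * (Matrix.vecMul y A.adjugate) i := by
      rw [hadj]
      simp only [Matrix.vecMul, dotProduct, Matrix.map_apply, Finset.mul_sum]
      refine Finset.sum_congr rfl fun j _ => ?_
      simp
      ring
    rw [← this]
  rw [hmem]
  constructor
  · intro h
    refine ⟨(D : ℝ)⁻¹ • Matrix.vecMul x A.adjugate, fun i => ?_, ?_⟩
    · have h1 : (D : ℝ)⁻¹ * (Matrix.vecMul x A.adjugate) i =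
          ((D : ℝ)⁻¹) ^ 2 * ((D : ℝ) * (Matrix.vecMul x A.adjugate) i) := by
        field_simp
      rw [Pi.smul_apply, smul_eq_mul, h1]
      exact mul_nonneg (sq_nonneg _) (h i)
    · rw [castVec_sum_smul_eq_vecMul, ← hA, Matrix.smul_vecMul, Matrix.vecMul_vecMul,
        Matrix.adjugate_mul, hdet, Matrix.vecMul_smul, Matrix.vecMul_one, smul_smul,
        inv_mul_cancel₀ hD', one_smul]
  · rintro ⟨r, hr, rfl⟩ i
    rw [castVec_sum_smul_eq_vecMul, ← hA, Matrix.vecMul_vecMul, Matrix.mul_adjugate, hdet,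
      Matrix.vecMul_smul, Matrix.vecMul_one, Pi.smul_apply, smul_eq_mul, ← mul_assoc]
    exact mul_nonneg (mul_self_nonneg _) (hr i)

/-- Every lattice point of the simplicial cone over `b` has a multiple in the monoid generated
by `b`, namely the one by the square of the determinant. -/
theorem det_sq_nsmul_mem_closure {b : Fin d → Fin d → ℤ} {z : Fin d → ℤ}
    (hz : castVec ℝ d z ∈ simplicialCone b) :
    ((Matrix.of b).det.natAbs ^ 2) • z ∈ AddSubmonoid.closure (Set.range b) := by
  set D := (Matrix.of b).det with hD
  have hz' : ∀ i, 0 ≤ D * Matrix.vecMul z (Matrix.of b).adjugate i := by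
    intro i
    have h := hz i
    have h2 : ∑ j, ((D * (Matrix.of b).adjugate j i : ℤ) : ℝ) * castVec ℝ d z j =
        ((D * Matrix.vecMul z (Matrix.of b).adjugate i : ℤ) : ℝ) := by
      simp only [Matrix.vecMul, dotProduct, Finset.mul_sum, castVec_apply]
      push_cast
      exact Finset.sum_congr rfl fun j _ => by ring
    rw [← hD, h2] at h
    exact_mod_cast h
  have h1 : ((D.natAbs ^ 2) • z : Fin d → ℤ) =
      ∑ i, (D * Matrix.vecMul z (Matrix.of b).adjugate i).toNat • b i := by
    have h2 : ∑ i, (D * Matrix.vecMul z (Matrix.of b).adjugate i).toNat • b i =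
        D • Matrix.vecMul (Matrix.vecMul z (Matrix.of b).adjugate) (Matrix.of b) := by
      rw [Matrix.vecMul_eq_sum (Matrix.vecMul z (Matrix.of b).adjugate), Finset.smul_sum]
      refine Finset.sum_congr rfl fun i _ => ?_
      rw [← natCast_zsmul, Int.toNat_of_nonneg (hz' i), mul_smul]
      rfl
    rw [h2, Matrix.vecMul_vecMul, Matrix.adjugate_mul, Matrix.vecMul_smul, Matrix.vecMul_one,
      smul_smul, ← natCast_zsmul]
    congr 1
    push_cast
    rw [sq_abs, sq]
  rw [h1]
  exact sum_mem fun i _ => nsmul_mem (AddSubmonoid.subset_closure (Set.mem_range_self i)) _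

theorem mem_realCone_iff_exists_simplicialCone {S : Finset (Fin d → ℤ)}
    (hS : Submodule.span ℝ (castVec ℝ d '' S) = ⊤) {x : Fin d → ℝ} :
    x ∈ realCone (S : Set (Fin d → ℤ)) ↔
      ∃ b : Fin d → S, (Matrix.of fun i => (b i : Fin d → ℤ)).det ≠ 0 ∧
        x ∈ simplicialCone fun i => (b i : Fin d → ℤ) := by
  classical
  constructor
  · intro hx
    have hS' : Submodule.span ℝ ((S.image (castVec ℝ d) : Finset _) : Set (Fin d → ℝ)) = ⊤ := by
      rw [Finset.coe_image, hS]
    obtain ⟨b, hb, hind, r, hr, hx⟩ := PointedCone.exists_basis_of_mem_hull hS'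
      (x := x) (by rw [Finset.coe_image]; exact hx)
    simp only [Finset.mem_image] at hb
    choose b' hb' hbb' using hb
    have hdet : (Matrix.of b').det ≠ 0 := by
      intro h
      have h1 : (Matrix.of b).det = 0 := by
        have : Matrix.of b = (Int.castRingHom ℝ).mapMatrix (Matrix.of b') := by
          ext i j
          simp [← hbb' i]
        rw [this, ← RingHom.map_det, h, map_zero]
      have h2 := (Matrix.linearIndependent_rows_iff_isUnit (A := Matrix.of b)).mp hind
      rw [Matrix.isUnit_iff_isUnit_det, h1] at h2
      exact not_isUnit_zero h2
    refine ⟨fun i => ⟨b' i, hb' i⟩, hdet, ?_⟩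
    rw [mem_simplicialCone_iff hdet]
    exact ⟨r, hr, by simpa [hbb'] using hx⟩
  · rintro ⟨b, hdet, hx⟩
    obtain ⟨r, hr, rfl⟩ := (mem_simplicialCone_iff hdet).mp hx
    exact sum_mem fun i _ => PointedCone.smul_mem _ (hr i)
      (PointedCone.subset_hull (Set.mem_image_of_mem _ (b i).2))

/-- A lattice point of the cone over `S` has a positive multiple in the monoid generated
by `S`. -/
theorem exists_nsmul_mem_closure_of_mem_realCone {S : Finset (Fin d → ℤ)}
    (hS : Submodule.span ℝ (castVec ℝ d '' S) = ⊤) {z : Fin d → ℤ}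
    (hz : castVec ℝ d z ∈ realCone (S : Set (Fin d → ℤ))) :
    ∃ n : ℕ, 1 ≤ n ∧ n • z ∈ AddSubmonoid.closure (S : Set (Fin d → ℤ)) := by
  obtain ⟨b, hdet, hz⟩ := (mem_realCone_iff_exists_simplicialCone hS).mp hz
  refine ⟨_, ?_, AddSubmonoid.closure_mono ?_ (det_sq_nsmul_mem_closure hz)⟩
  · exact Nat.one_le_pow _ _ (Nat.pos_of_ne_zero (Int.natAbs_ne_zero.mpr hdet))
  · rintro _ ⟨i, rfl⟩
    exact (b i).2

theorem indicator_simplicialCone_mem (b : Fin d → Fin d → ℤ) :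
    (simplicialCone b).indicator 1 ∈ piecewisePoly d := by
  have h : simplicialCone b = ⋂ i ∈ (Finset.univ : Finset (Fin d)), {x | 0 ≤ ratAffine
      (fun j => (((Matrix.of b).det * (Matrix.of b).adjugate j i : ℤ) : ℚ)) 0 x} := by
    ext x
    simp [simplicialCone, ratAffine]
  rw [h]
  exact piecewisePoly.indicator_biInter_mem _ fun i _ => piecewisePoly.indicator_halfSpace_mem _ _

theorem indicator_realCone_mem {S : Finset (Fin d → ℤ)}
    (hS : Submodule.span ℝ (castVec ℝ d '' S) = ⊤) :
    (realCone (S : Set (Fin d → ℤ)) : Set (Fin d → ℝ)).indicator 1 ∈ piecewisePoly d := by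
  classical
  have h : (realCone (S : Set (Fin d → ℤ)) : Set (Fin d → ℝ)) =
      ⋃ b ∈ Finset.univ.filter
        fun b : Fin d → S => (Matrix.of fun i => (b i : Fin d → ℤ)).det ≠ 0,
        simplicialCone fun i => (b i : Fin d → ℤ) := by
    ext x
    rw [SetLike.mem_coe, mem_realCone_iff_exists_simplicialCone hS]
    simp
  rw [h]
  exact piecewisePoly.indicator_biUnion_mem _ fun b _ => indicator_simplicialCone_mem _

end IntegralCone

/-! ### Volumes and lattice points of cone complements -/

section ConeComplement

variable {d : ℕ}

/-- The complement in the cone over `S` of the translates of the cone by the elements of `A`. -/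
def coneComplement (S A : Set (Fin d → ℤ)) : Set (Fin d → ℝ) :=
  (realCone S : Set (Fin d → ℝ)) \
    ⋃ a ∈ A, (fun x => castVec ℝ d a + x) '' (realCone S : Set (Fin d → ℝ))

theorem mem_coneComplement {S A : Set (Fin d → ℤ)} {x : Fin d → ℝ} :
    x ∈ coneComplement S A ↔ x ∈ realCone S ∧ ∀ a ∈ A, x - castVec ℝ d a ∉ realCone S := by
  simp only [coneComplement, Set.mem_sdiff, SetLike.mem_coe, Set.mem_iUnion, Set.mem_image,
    not_exists, not_and]
  refine and_congr_right fun _ => forall₂_congr fun a _ => ?_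
  constructor
  · intro h hx
    exact h _ hx (by abel)
  · rintro h y hy rfl
    exact h (by simpa using hy)

theorem frontier_diff_null {s t : Set (Fin d → ℝ)} (hs : volume (frontier s) = 0)
    (ht : volume (frontier t) = 0) : volume (frontier (s \ t)) = 0 := by
  rw [Set.sdiff_eq]
  refine measure_mono_null (frontier_inter_subset _ _) (measure_union_null ?_ ?_)
  · exact measure_mono_null Set.inter_subset_left hs
  · rw [frontier_compl]
    exact measure_mono_null Set.inter_subset_right ht

theorem frontier_coneComplement_null (S : Set (Fin d → ℤ)) {A : Set (Fin d → ℤ)}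
    (hA : A.Finite) : volume (frontier (coneComplement S A)) = 0 := by
  have hC : Convex ℝ (realCone S : Set (Fin d → ℝ)) := (realCone S).convex
  refine frontier_diff_null (hC.addHaar_frontier volume) ?_
  induction A, hA using Set.Finite.induction_on with
  | empty => simp
  | @insert a A _ _ ih =>
    rw [Set.biUnion_insert]
    refine measure_mono_null (frontier_union_subset _ _) (measure_union_null ?_ ?_)
    · exact measure_mono_null Set.inter_subset_left
        ((hC.translate (castVec ℝ d a)).addHaar_frontier volume)
    · exact measure_mono_null Set.inter_subset_right ih

theorem indicator_coneComplement_mem {S : Finset (Fin d → ℤ)}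
    (hS : Submodule.span ℝ (castVec ℝ d '' S) = ⊤) (A : Finset (Fin d → ℤ)) :
    (coneComplement (S : Set (Fin d → ℤ)) A).indicator 1 ∈ piecewisePoly d := by
  have hC := indicator_realCone_mem hS
  rw [coneComplement, Set.sdiff_eq]
  refine piecewisePoly.indicator_inter_mem hC (piecewisePoly.indicator_compl_mem ?_)
  refine piecewisePoly.indicator_biUnion_mem A fun a _ => ?_
  convert piecewisePoly.comp_sub_mem hC (fun i => (a i : ℚ)) using 1
  ext x
  have h : x ∈ (fun x => castVec ℝ d a + x) '' (realCone (S : Set (Fin d → ℤ)) : Set (Fin d → ℝ)) ↔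
      (fun i => x i - ((a i : ℚ) : ℝ)) ∈ (realCone (S : Set (Fin d → ℤ)) : Set (Fin d → ℝ)) := by
    have h1 : (fun i => x i - ((a i : ℚ) : ℝ)) = -castVec ℝ d a + x := by
      ext i
      simp
      ring
    rw [h1, Set.image_add_left]
    rfl
  by_cases hx : (fun i => x i - ((a i : ℚ) : ℝ)) ∈
      (realCone (S : Set (Fin d → ℤ)) : Set (Fin d → ℝ))
  · rw [Set.indicator_of_mem (h.mpr hx), Set.indicator_of_mem hx, Pi.one_apply, Pi.one_apply]
  · rw [Set.indicator_of_notMem (fun h' => hx (h.mp h')), Set.indicator_of_notMem hx]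

/-- If each generator of the cone has a multiple in one of the translates, the coefficients of
a point outside of all translates are bounded by these multiples. -/
theorem isBounded_coneComplement {S : Finset (Fin d → ℤ)} {A : Set (Fin d → ℤ)}
    (hA : ∀ s ∈ S, s ≠ 0 → ∃ n : ℕ, ∃ a ∈ A,
      n • s - a ∈ AddSubmonoid.closure (S : Set (Fin d → ℤ))) :
    Bornology.IsBounded (coneComplement (S : Set (Fin d → ℤ)) A) := by
  classical
  choose! n a haA hna using hA
  refine (isBounded_iff_forall_norm_le.mpr
    ⟨∑ s ∈ S, n s * ‖castVec ℝ d s‖, fun x hx => ?_⟩)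
  obtain ⟨hxC, hx⟩ := mem_coneComplement.mp hx
  have hsub : ∀ s ∈ S, castVec ℝ d s ∈ realCone (S : Set (Fin d → ℤ)) := fun s hs =>
    castVec_mem_realCone (AddSubmonoid.subset_closure hs)
  obtain ⟨f, hf, hfx⟩ : ∃ f : (Fin d → ℤ) → ℝ, (∀ s ∈ S, 0 ≤ f s) ∧
      ∑ s ∈ S, f s • castVec ℝ d s = x := by
    rw [realCone, ← Finset.coe_image] at hxC
    obtain ⟨f, hf, hfx⟩ := PointedCone.mem_hull_finset.mp hxC
    refine ⟨fun s => f (castVec ℝ d s), fun s hs => hf _ (Finset.mem_image_of_mem _ hs), ?_⟩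
    rw [← hfx, Finset.sum_image (castVec_injective ℝ).injOn]
  rw [← hfx]
  refine (norm_sum_le _ _).trans (Finset.sum_le_sum fun s hs => ?_)
  rcases eq_or_ne s 0 with rfl | h0
  · simp
  rw [norm_smul, Real.norm_of_nonneg (hf s hs)]
  refine mul_le_mul_of_nonneg_right ?_ (norm_nonneg _)
  by_contra! hlt
  refine hx (a s) (haA s hs h0) ?_
  have h1 : x - castVec ℝ d (a s) = (f s - n s) • castVec ℝ d s +
      ∑ t ∈ S.erase s, f t • castVec ℝ d t + castVec ℝ d (n s • s - a s) := by
    rw [← hfx, ← Finset.add_sum_erase S _ hs, map_sub, map_nsmul, sub_smul, Nat.cast_smul_eq_nsmul]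
    abel
  rw [h1]
  refine add_mem (add_mem (PointedCone.smul_mem _ (by linarith) (hsub s hs))
    (sum_mem fun t ht => ?_)) (castVec_mem_realCone (hna s hs h0))
  have ht' := Finset.mem_of_mem_erase ht
  exact PointedCone.smul_mem _ (hf t ht') (hsub t ht')

/-- The elements of the monoid `M` outside of the translates of `M` by the `q`-fold multiples of the
elements of `A`. -/
def latticeComplement (M : AddSubmonoid (Fin d → ℤ)) (A : Set (Fin d → ℤ)) (q : ℕ) :
    Set (Fin d → ℤ) :=
  {z | z ∈ M ∧ ∀ a ∈ A, z - q • a ∉ M}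

/-- The lattice points of the cone over a saturated monoid are the elements of the monoid. -/
theorem castVec_mem_realCone_iff {S : Finset (Fin d → ℤ)}
    (hS : Submodule.span ℝ (castVec ℝ d '' S) = ⊤)
    (hsat : ∀ (z : Fin d → ℤ) (n : ℕ), 1 ≤ n →
      n • z ∈ AddSubmonoid.closure (S : Set (Fin d → ℤ)) →
        z ∈ AddSubmonoid.closure (S : Set (Fin d → ℤ))) {z : Fin d → ℤ} :
    castVec ℝ d z ∈ realCone (S : Set (Fin d → ℤ)) ↔
      z ∈ AddSubmonoid.closure (S : Set (Fin d → ℤ)) := by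
  refine ⟨fun h => ?_, castVec_mem_realCone⟩
  obtain ⟨n, hn, h⟩ := exists_nsmul_mem_closure_of_mem_realCone hS h
  exact hsat z n hn h

/-- Scaling by `1/q` identifies the lattice points outside of the dilated translates with the
points of `q⁻¹ℤᵈ` in the complement of the translates. -/
theorem mem_latticeComplement_iff {S : Finset (Fin d → ℤ)}
    (hS : Submodule.span ℝ (castVec ℝ d '' S) = ⊤)
    (hsat : ∀ (z : Fin d → ℤ) (n : ℕ), 1 ≤ n →
      n • z ∈ AddSubmonoid.closure (S : Set (Fin d → ℤ)) →
        z ∈ AddSubmonoid.closure (S : Set (Fin d → ℤ)))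
    (A : Set (Fin d → ℤ)) {q : ℕ} (hq : 1 ≤ q) (z : Fin d → ℤ) :
    z ∈ latticeComplement (AddSubmonoid.closure (S : Set (Fin d → ℤ))) A q ↔
      (q : ℝ)⁻¹ • castVec ℝ d z ∈ coneComplement (S : Set (Fin d → ℤ)) A := by
  have hq' : (0 : ℝ) < (q : ℝ)⁻¹ := inv_pos.mpr (by exact_mod_cast hq)
  have hsm : ∀ z : Fin d → ℤ, (q : ℝ)⁻¹ • castVec ℝ d z ∈ realCone (S : Set (Fin d → ℤ)) ↔
      z ∈ AddSubmonoid.closure (S : Set (Fin d → ℤ)) := fun z => by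
    rw [← castVec_mem_realCone_iff hS hsat]
    exact PointedCone.smul_mem_iff _ hq'
  rw [mem_coneComplement, hsm]
  refine and_congr_right fun _ => forall₂_congr fun a _ => not_congr ?_
  rw [← hsm, map_sub, map_nsmul, smul_sub, ← Nat.cast_smul_eq_nsmul ℝ, smul_smul,
    inv_mul_cancel₀ (inv_pos.mp hq').ne', one_smul]

theorem finite_latticeComplement {S : Finset (Fin d → ℤ)}
    (hS : Submodule.span ℝ (castVec ℝ d '' S) = ⊤)
    (hsat : ∀ (z : Fin d → ℤ) (n : ℕ), 1 ≤ n →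
      n • z ∈ AddSubmonoid.closure (S : Set (Fin d → ℤ)) →
        z ∈ AddSubmonoid.closure (S : Set (Fin d → ℤ)))
    {A : Set (Fin d → ℤ)}
    (hb : Bornology.IsBounded (coneComplement (S : Set (Fin d → ℤ)) A)) {q : ℕ} (hq : 1 ≤ q) :
    (latticeComplement (AddSubmonoid.closure (S : Set (Fin d → ℤ))) A q).Finite := by
  obtain ⟨R, hR⟩ := isBounded_iff_forall_norm_le.mp hb
  obtain ⟨m, hm⟩ := exists_nat_ge (q * R)
  refine (Set.finite_Icc (fun _ => -(m : ℤ)) (fun _ => (m : ℤ))).subset fun z hz => ?_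
  have h1 := hR _ ((mem_latticeComplement_iff hS hsat A hq z).mp hz)
  have hq' : (0 : ℝ) < q := by exact_mod_cast hq
  rw [norm_smul, norm_inv, Real.norm_of_nonneg hq'.le, inv_mul_le_iff₀ hq'] at h1
  have h2 : ∀ i, |z i| ≤ m := fun i => by
    have h3 := (norm_le_pi_norm (castVec ℝ d z) i).trans (h1.trans hm)
    rw [castVec_apply, Real.norm_eq_abs] at h3
    exact_mod_cast h3
  exact ⟨fun i => (abs_le.mp (h2 i)).1, fun i => (abs_le.mp (h2 i)).2⟩

theorem mem_span_basisFun_iff {x : Fin d → ℝ} :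
    x ∈ Submodule.span ℤ (Set.range (Pi.basisFun ℝ (Fin d))) ↔ ∃ z, castVec ℝ d z = x := by
  rw [Module.Basis.mem_span_iff_repr_mem]
  simp only [Pi.basisFun_repr, Set.mem_range, algebraMap_int_eq, eq_intCast]
  constructor
  · intro h
    choose z hz using h
    exact ⟨z, funext hz⟩
  · rintro ⟨z, rfl⟩ i
    exact ⟨z i, rfl⟩

open Pointwise in
/-- The number of lattice points outside of the dilated translates grows like the volume of the
complement of the translates. -/
theorem tendsto_card_latticeComplement {S : Finset (Fin d → ℤ)}
    (hS : Submodule.span ℝ (castVec ℝ d '' S) = ⊤)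
    (hsat : ∀ (z : Fin d → ℤ) (n : ℕ), 1 ≤ n →
      n • z ∈ AddSubmonoid.closure (S : Set (Fin d → ℤ)) →
        z ∈ AddSubmonoid.closure (S : Set (Fin d → ℤ)))
    {A : Finset (Fin d → ℤ)}
    (hb : Bornology.IsBounded (coneComplement (S : Set (Fin d → ℤ)) A)) :
    Tendsto (fun q : ℕ => (Nat.card (latticeComplement
        (AddSubmonoid.closure (S : Set (Fin d → ℤ))) A q) : ℝ) / (q : ℝ) ^ d) atTop
      (𝓝 (volume.real (coneComplement (S : Set (Fin d → ℤ)) A))) := by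
  have h := tendsto_card_div_pow_atTop_volume (coneComplement (S : Set (Fin d → ℤ)) A) hb
    (piecewisePoly.measurableSet_of_indicator_mem (indicator_coneComplement_mem hS A))
    (frontier_coneComplement_null _ A.finite_toSet)
  rw [Fintype.card_fin] at h
  refine h.congr' ?_
  filter_upwards [eventually_ge_atTop 1] with q hq
  have hq' : (q : ℝ)⁻¹ ≠ 0 := inv_ne_zero (by exact_mod_cast (by omega : q ≠ 0))
  congr 2
  have himg : coneComplement (S : Set (Fin d → ℤ)) A ∩ (q : ℝ)⁻¹ •
      (Submodule.span ℤ (Set.range (Pi.basisFun ℝ (Fin d))) : Set (Fin d → ℝ)) =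
      (fun z => (q : ℝ)⁻¹ • castVec ℝ d z) '' latticeComplement
        (AddSubmonoid.closure (S : Set (Fin d → ℤ))) A q := by
    ext x
    constructor
    · rintro ⟨hx, y, hy, rfl⟩
      obtain ⟨z, rfl⟩ := mem_span_basisFun_iff.mp hy
      exact ⟨z, (mem_latticeComplement_iff hS hsat _ hq z).mpr hx, rfl⟩
    · rintro ⟨z, hz, rfl⟩
      exact ⟨(mem_latticeComplement_iff hS hsat _ hq z).mp hz,
        castVec ℝ d z, mem_span_basisFun_iff.mpr ⟨z, rfl⟩, rfl⟩
  rw [himg]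
  exact Nat.card_image_of_injective
    ((smul_right_injective _ hq').comp (castVec_injective ℝ)) _

end ConeComplement

/-! ### The difference group of a binoid -/

namespace Binoid

variable {N : Type*} [Binoid N]

theorem add_infty (a : N) : a + infty = infty := by rw [add_comm, infty_add]

theorem left_ne_infty {a b : N} (h : a + b ≠ infty) : a ≠ infty := by
  rintro rfl
  exact h (infty_add b)

theorem right_ne_infty {a b : N} (h : a + b ≠ infty) : b ≠ infty := by
  rintro rfl
  exact h (add_infty a)

theorem IsIntegral.add_ne_infty (hint : IsIntegral N) {a b : N} (ha : a ≠ infty)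
    (hb : b ≠ infty) : a + b ≠ infty := fun h => hb (hint a b ha h)

theorem IsIntegral.nsmul_ne_infty (hint : IsIntegral N) (h0 : (0 : N) ≠ infty) {a : N}
    (ha : a ≠ infty) (n : ℕ) : n • a ≠ infty := by
  induction n with
  | zero => simpa using h0
  | succ n ih => rw [succ_nsmul]; exact hint.add_ne_infty ih ha

theorem nsmul_infty {q : ℕ} (hq : 1 ≤ q) : q • (infty : N) = infty := by
  obtain ⟨k, rfl⟩ := Nat.exists_eq_add_of_le hq
  rw [add_nsmul, one_nsmul, infty_add]

theorem ne_infty_of_mem_bulletSubmonoid (hint : IsIntegral N) (h0 : (0 : N) ≠ infty) {a : N}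
    (ha : a ∈ bulletSubmonoid N) : a ≠ infty := by
  induction ha using AddSubmonoid.closure_induction with
  | mem a ha => exact ha
  | zero => exact h0
  | add a b _ _ ha hb => exact hint.add_ne_infty ha hb

theorem toDiff_eq_iff {a b : N} :
    toDiff N a = toDiff N b ↔ ∃ c : bulletSubmonoid N, (c : N) + a = c + b :=
  (AddLocalization.addMonoidOf (bulletSubmonoid N)).eq_iff_exists

theorem toDiff_injective (h0 : (0 : N) ≠ infty) (hint : IsIntegral N) (hcanc : IsCancellative N) :
    Function.Injective (toDiff N) := by
  intro a b h
  obtain ⟨⟨c, hc⟩, h⟩ := toDiff_eq_iff.mp h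
  have hc' := ne_infty_of_mem_bulletSubmonoid hint h0 hc
  dsimp only at h
  by_cases ha : a = infty
  · subst ha
    rw [add_infty] at h
    exact (hint c b hc' h.symm).symm
  · rw [add_comm c a, add_comm c b] at h
    exact hcanc a b c h (hint.add_ne_infty ha hc')

theorem ne_infty_of_isAddUnit_toDiff (h0 : (0 : N) ≠ infty) (hint : IsIntegral N)
    (hcanc : IsCancellative N) {a : N} (ha : IsAddUnit (toDiff N a)) : a ≠ infty := by
  rintro rfl
  obtain ⟨v, hv⟩ := ha.exists_neg
  have h1 : (infty : Diff N) + v = infty := infty_add v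
  have h2 : toDiff N infty = toDiff N 0 := by
    rw [map_zero, ← hv]
    exact h1.symm
  exact h0 (toDiff_injective h0 hint hcanc h2).symm

/-- Every element of the difference group is the difference of two elements of `N^•`. -/
theorem exists_eq_toDiffUnits_sub (h0 : (0 : N) ≠ infty) (hint : IsIntegral N)
    (hcanc : IsCancellative N) (u : AddUnits (Diff N)) :
    ∃ a b : {a : N // a ≠ infty}, u = toDiffUnits a - toDiffUnits b := by
  obtain ⟨⟨a, ⟨b, hbS⟩⟩, h⟩ := (AddLocalization.addMonoidOf (bulletSubmonoid N)).surj (u : Diff N)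
  have hb := ne_infty_of_mem_bulletSubmonoid hint h0 hbS
  have h' : (u : Diff N) + toDiff N b = toDiff N a := h
  have ha : a ≠ infty := by
    refine ne_infty_of_isAddUnit_toDiff h0 hint hcanc ?_
    rw [← h']
    exact u.isAddUnit.add (isAddUnit_toDiff ⟨b, hb⟩)
  refine ⟨⟨a, ha⟩, ⟨b, hb⟩, ?_⟩
  rw [eq_sub_iff_add_eq]
  exact AddUnits.ext h'

theorem toDiffUnits_add {a b : N} (ha : a ≠ infty) (hb : b ≠ infty) (h : a + b ≠ infty) :
    toDiffUnits ⟨a + b, h⟩ = toDiffUnits ⟨a, ha⟩ + toDiffUnits ⟨b, hb⟩ :=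
  AddUnits.ext (map_add (toDiff N) a b)

theorem toDiffUnits_zero (h : (0 : N) ≠ infty) : toDiffUnits ⟨0, h⟩ = 0 :=
  AddUnits.ext (map_zero (toDiff N))

theorem toDiffUnits_inj (h0 : (0 : N) ≠ infty) (hint : IsIntegral N) (hcanc : IsCancellative N)
    {a b : {a : N // a ≠ infty}} (h : toDiffUnits a = toDiffUnits b) : a = b :=
  Subtype.ext (toDiff_injective h0 hint hcanc (congrArg AddUnits.val h))

theorem toDiffUnits_nsmul (hint : IsIntegral N) (h0 : (0 : N) ≠ infty) {a : N} (ha : a ≠ infty)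
    (n : ℕ) : toDiffUnits ⟨n • a, hint.nsmul_ne_infty h0 ha n⟩ = n • toDiffUnits ⟨a, ha⟩ := by
  refine AddUnits.ext ?_
  rw [AddUnits.val_nsmul_eq_nsmul_val]
  exact map_nsmul (toDiff N) n a

/-- The image of `N^•` in the difference group is a finitely generated monoid. -/
theorem exists_finset_closure_toDiffUnits (hfg : IsFinitelyGenerated N) :
    ∃ T : Finset (AddUnits (Diff N)), (∀ t ∈ T, ∃ a, toDiffUnits a = t) ∧
      ∀ a, toDiffUnits a ∈ AddSubmonoid.closure (T : Set (AddUnits (Diff N))) := by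
  classical
  obtain ⟨S, hS⟩ := hfg
  refine ⟨(S.subtype (fun a => a ≠ infty)).image toDiffUnits, ?_, ?_⟩
  · intro t ht
    obtain ⟨a, -, h⟩ := Finset.mem_image.mp ht
    exact ⟨a, h⟩
  · rintro ⟨a, ha⟩
    have hmem : a ∈ AddSubmonoid.closure (insert infty (S : Set N)) := by rw [hS]; trivial
    induction hmem using AddSubmonoid.closure_induction with
    | mem a h =>
      rcases h with h | h
      · exact absurd h ha
      · refine AddSubmonoid.subset_closure (Finset.mem_coe.mpr (Finset.mem_image_of_mem _ ?_))
        exact Finset.mem_subtype.mpr h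
    | zero => rw [toDiffUnits_zero]; exact zero_mem _
    | add a b _ _ iha ihb =>
      rw [toDiffUnits_add (left_ne_infty ha) (right_ne_infty ha)]
      exact add_mem (iha _) (ihb _)

/-- The difference group of a finitely generated torsion-free cancellative binoid is free of
finite rank, being finitely generated and torsion-free. -/
theorem exists_addUnits_diff_equiv (hfg : IsFinitelyGenerated N) (h0 : (0 : N) ≠ infty)
    (hint : IsIntegral N) (hcanc : IsCancellative N) (htf : IsTorsionFree N) :
    ∃ d : ℕ, Nonempty (AddUnits (Diff N) ≃+ (Fin d → ℤ)) := by
  have hT : IsAddTorsionFree (AddUnits (Diff N)) := by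
    have key : ∀ (n : ℕ) (u : AddUnits (Diff N)), n ≠ 0 → n • u = 0 → u = 0 := by
      intro n u hn hu
      obtain ⟨⟨a, ha⟩, ⟨b, hb⟩, rfl⟩ := exists_eq_toDiffUnits_sub h0 hint hcanc u
      rw [nsmul_sub, sub_eq_zero, ← toDiffUnits_nsmul hint h0, ← toDiffUnits_nsmul hint h0] at hu
      have h := congrArg Subtype.val (toDiffUnits_inj h0 hint hcanc hu)
      have hab := htf a b n (Nat.one_le_iff_ne_zero.mpr hn) h
      subst hab
      exact sub_self _
    refine ⟨fun n hn u v h => sub_eq_zero.mp (key n _ hn ?_)⟩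
    rw [nsmul_sub, sub_eq_zero]
    exact h
  have hF : Module.Finite ℤ (AddUnits (Diff N)) := by
    obtain ⟨T, -, hT⟩ := exists_finset_closure_toDiffUnits hfg
    refine Module.Finite.iff_addGroup_fg.mpr (AddGroup.fg_iff.mpr ⟨T, ?_, T.finite_toSet⟩)
    rw [eq_top_iff]
    intro u _
    have hle : AddSubmonoid.closure (T : Set (AddUnits (Diff N))) ≤
        (AddSubgroup.closure (T : Set (AddUnits (Diff N)))).toAddSubmonoid :=
      AddSubmonoid.closure_le.mpr AddSubgroup.subset_closure
    obtain ⟨a, b, rfl⟩ := exists_eq_toDiffUnits_sub h0 hint hcanc u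
    exact sub_mem (hle (hT a)) (hle (hT b))
  have := Module.free_of_finite_type_torsion_free' (R := ℤ) (M := AddUnits (Diff N))
  exact ⟨_, ⟨(Module.finBasis ℤ (AddUnits (Diff N))).equivFun.toAddEquiv⟩⟩

/-! ### The lattice monoid of a binoid -/

variable {d : ℕ}

/-- The coordinates of an element of `N^•` under an identification of the difference group
with `ℤᵈ`. -/
noncomputable def latVec (φ : AddUnits (Diff N) ≃+ (Fin d → ℤ)) (a : {a : N // a ≠ infty}) :
    Fin d → ℤ := φ (toDiffUnits a)

theorem latticePoint_eq (φ : AddUnits (Diff N) ≃+ (Fin d → ℤ)) (a : {a : N // a ≠ infty}) :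
    latticePoint φ a = castVec ℝ d (latVec φ a) := rfl

variable (φ : AddUnits (Diff N) ≃+ (Fin d → ℤ))

theorem latVec_add {a b : N} (ha : a ≠ infty) (hb : b ≠ infty) (h : a + b ≠ infty) :
    latVec φ ⟨a + b, h⟩ = latVec φ ⟨a, ha⟩ + latVec φ ⟨b, hb⟩ := by
  rw [latVec, toDiffUnits_add ha hb, map_add]; rfl

theorem latVec_zero (h : (0 : N) ≠ infty) : latVec φ ⟨0, h⟩ = 0 := by
  rw [latVec, toDiffUnits_zero, map_zero]

theorem latVec_nsmul (hint : IsIntegral N) (h0 : (0 : N) ≠ infty) {a : N} (ha : a ≠ infty)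
    (n : ℕ) (h : n • a ≠ infty) : latVec φ ⟨n • a, h⟩ = n • latVec φ ⟨a, ha⟩ := by
  rw [latVec, toDiffUnits_nsmul hint h0 ha, map_nsmul]; rfl

theorem latVec_inj (h0 : (0 : N) ≠ infty) (hint : IsIntegral N) (hcanc : IsCancellative N)
    {a b : {a : N // a ≠ infty}} (h : latVec φ a = latVec φ b) : a = b :=
  toDiffUnits_inj h0 hint hcanc (φ.injective h)

theorem exists_eq_latVec_sub (h0 : (0 : N) ≠ infty) (hint : IsIntegral N)
    (hcanc : IsCancellative N) (z : Fin d → ℤ) : ∃ a b, z = latVec φ a - latVec φ b := by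
  obtain ⟨a, b, h⟩ := exists_eq_toDiffUnits_sub h0 hint hcanc (φ.symm z)
  refine ⟨a, b, ?_⟩
  rw [latVec, latVec, ← map_sub, ← h, AddEquiv.apply_symm_apply]

/-- Normality says that the image of `N^•` in `ℤᵈ` is a saturated monoid. -/
theorem mem_range_latVec_of_nsmul (h0 : (0 : N) ≠ infty) (hint : IsIntegral N)
    (hcanc : IsCancellative N) (hnorm : IsNormal N) {z : Fin d → ℤ} {n : ℕ} (hn : 1 ≤ n)
    (hz : n • z ∈ Set.range (latVec φ)) : z ∈ Set.range (latVec φ) := by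
  obtain ⟨a, ha⟩ := hz
  set u := φ.symm z with hu
  have h1 : n • u = toDiffUnits a := by
    apply φ.injective
    rw [map_nsmul, hu, AddEquiv.apply_symm_apply]
    exact ha.symm
  have h2 : (u : Diff N) ∈ normalization N := by
    refine ⟨n, hn, a, ?_⟩
    rw [← AddUnits.val_nsmul_eq_nsmul_val, h1]
    rfl
  rw [← hnorm] at h2
  obtain ⟨b, hb⟩ := h2
  have hb' : b ≠ infty := by
    refine ne_infty_of_isAddUnit_toDiff h0 hint hcanc ?_
    rw [hb]
    exact u.isAddUnit
  refine ⟨⟨b, hb'⟩, ?_⟩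
  have h3 : toDiffUnits ⟨b, hb'⟩ = u := AddUnits.ext hb
  rw [latVec, h3, hu, AddEquiv.apply_symm_apply]

/-- The image of `N^•` in `ℤᵈ` is generated by finitely many vectors. -/
theorem exists_finset_closure_eq_range_latVec (hfg : IsFinitelyGenerated N)
    (h0 : (0 : N) ≠ infty) (hint : IsIntegral N) : ∃ S : Finset (Fin d → ℤ),
      (AddSubmonoid.closure (S : Set (Fin d → ℤ)) : Set (Fin d → ℤ)) = Set.range (latVec φ) := by
  classical
  obtain ⟨T, hT, hT'⟩ := exists_finset_closure_toDiffUnits hfg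
  refine ⟨T.image φ, Set.Subset.antisymm ?_ ?_⟩
  · intro z hz
    induction hz using AddSubmonoid.closure_induction with
    | mem z hz =>
      obtain ⟨t, ht, rfl⟩ := Finset.mem_image.mp hz
      obtain ⟨a, rfl⟩ := hT t ht
      exact ⟨a, rfl⟩
    | zero => exact ⟨⟨0, h0⟩, latVec_zero φ h0⟩
    | add x y _ _ hx hy =>
      obtain ⟨a, rfl⟩ := hx
      obtain ⟨b, rfl⟩ := hy
      exact ⟨⟨a + b, hint.add_ne_infty a.2 b.2⟩, latVec_add φ a.2 b.2 _⟩
  · rintro _ ⟨a, rfl⟩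
    have h := AddSubmonoid.mem_map_of_mem φ.toAddMonoidHom (hT' a)
    rw [AddMonoidHom.map_mclosure] at h
    rw [Finset.coe_image]
    exact h

theorem span_castVec_eq_top (K : Type*) [Field K] (h0 : (0 : N) ≠ infty) (hint : IsIntegral N)
    (hcanc : IsCancellative N) {S : Finset (Fin d → ℤ)}
    (hS : (AddSubmonoid.closure (S : Set (Fin d → ℤ)) : Set (Fin d → ℤ)) = Set.range (latVec φ)) :
    Submodule.span K (castVec K d '' S) = ⊤ := by
  have hmem : ∀ z ∈ AddSubmonoid.closure (S : Set (Fin d → ℤ)),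
      castVec K d z ∈ Submodule.span K (castVec K d '' S) := by
    intro z hz
    induction hz using AddSubmonoid.closure_induction with
    | mem z hz => exact Submodule.subset_span ⟨z, hz, rfl⟩
    | zero => simp
    | add x y _ _ hx hy => rw [map_add]; exact add_mem hx hy
  have hall : ∀ z, castVec K d z ∈ Submodule.span K (castVec K d '' S) := by
    intro z
    obtain ⟨a, b, rfl⟩ := exists_eq_latVec_sub φ h0 hint hcanc z
    rw [map_sub]
    refine sub_mem (hmem _ ?_) (hmem _ ?_)
    · rw [← SetLike.mem_coe, hS]; exact ⟨a, rfl⟩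
    · rw [← SetLike.mem_coe, hS]; exact ⟨b, rfl⟩
  rw [eq_top_iff]
  intro x _
  have hx : x = ∑ i, x i • castVec K d (Pi.single i 1) := by
    ext j
    simp [Finset.sum_apply, Pi.single_apply]
  rw [hx]
  exact sum_mem fun i _ => Submodule.smul_mem _ _ (hall _)

end Binoid

/-! ### Finite generation of ideals -/

/-- A finitely generated commutative monoid satisfies Dickson's lemma: a subset has a finite
subset of which every element of the subset is a translate. -/
theorem exists_finset_forall_sub_mem_closure {G : Type*} [AddCommGroup G] (S : Finset G)
    (J : Set G) (hJ : J ⊆ AddSubmonoid.closure (S : Set G)) :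
    ∃ A : Finset G, (A : Set G) ⊆ J ∧
      ∀ b ∈ J, ∃ a ∈ A, b - a ∈ AddSubmonoid.closure (S : Set G) := by
  classical
  let f : (S → ℕ) → G := fun m => ∑ s : S, m s • (s : G)
  have hf : ∀ m, f m ∈ AddSubmonoid.closure (S : Set G) := fun m =>
    sum_mem fun s _ => nsmul_mem (AddSubmonoid.subset_closure s.2) _
  have hfin : {m | Minimal (fun m => f m ∈ J) m}.Finite :=
    WellQuasiOrderedLE.finite_of_isAntichain (setOfPred_minimal_antichain _)
  refine ⟨hfin.toFinset.image f, ?_, ?_⟩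
  · intro z hz
    rw [Finset.coe_image] at hz
    obtain ⟨m, hm, rfl⟩ := hz
    have hm' : Minimal (fun m => f m ∈ J) m := hfin.mem_toFinset.mp (Finset.mem_coe.mp hm)
    exact hm'.prop
  · intro b hb
    obtain ⟨g, -, hg⟩ := AddSubmonoid.mem_closure_finset.mp (hJ hb)
    have hgb : f (fun s => g s) = b := by
      rw [← hg]
      exact Finset.sum_coe_sort S fun s => g s • s
    obtain ⟨m, hm, hmin⟩ := exists_minimal_le_of_wellFoundedLT (fun m => f m ∈ J)
      (fun s => g s) (by rw [hgb]; exact hb)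
    refine ⟨f m, Finset.mem_image_of_mem _ (hfin.mem_toFinset.mpr hmin), ?_⟩
    have h : b - f m = f (fun s => g s - m s) := by
      rw [← hgb, sub_eq_iff_eq_add, ← Finset.sum_add_distrib]
      refine Finset.sum_congr rfl fun s _ => ?_
      rw [← add_nsmul, Nat.sub_add_cancel (hm s)]
    rw [h]
    exact hf _

section

variable {d : ℕ}

theorem coneComplement_eq_of_forall_sub_mem {S A J : Set (Fin d → ℤ)} (hAJ : A ⊆ J)
    (h : ∀ b ∈ J, ∃ a ∈ A, b - a ∈ AddSubmonoid.closure S) :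
    coneComplement S A = coneComplement S J := by
  ext x
  rw [mem_coneComplement, mem_coneComplement]
  refine and_congr_right fun _ => ⟨fun hx b hb hxb => ?_, fun hx a ha => hx a (hAJ ha)⟩
  obtain ⟨a, ha, hba⟩ := h b hb
  refine hx a ha ?_
  have h1 : x - castVec ℝ d a = x - castVec ℝ d b + castVec ℝ d (b - a) := by
    rw [map_sub]; abel
  rw [h1]
  exact add_mem hxb (castVec_mem_realCone hba)

theorem latticeComplement_eq_of_forall_sub_mem {M : AddSubmonoid (Fin d → ℤ)}
    {A J : Set (Fin d → ℤ)} (hAJ : A ⊆ J) (h : ∀ b ∈ J, ∃ a ∈ A, b - a ∈ M) (q : ℕ) :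
    latticeComplement M A q = latticeComplement M J q := by
  ext z
  refine and_congr_right fun _ => ⟨fun hz b hb hzb => ?_, fun hz a ha => hz a (hAJ ha)⟩
  obtain ⟨a, ha, hba⟩ := h b hb
  refine hz a ha ?_
  have h1 : z - q • a = z - q • b + q • (b - a) := by rw [nsmul_sub]; abel
  rw [h1]
  exact add_mem hzb (nsmul_mem hba q)

end

namespace Binoid

/-! ### The Hilbert–Kunz function as a lattice point count -/

section Rees

variable {N : Type*} [Binoid N] (J : Ideal N)

/-- The elements of `N/J` other than `∞` are the elements of `N` outside of `J`. -/
noncomputable def Ideal.complEquiv : {a : N // a ∉ J} ≃ {x : J.Quotient // x ≠ infty} :=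
  Equiv.ofBijective
    (fun a => ⟨J.reesCon.mk' a, fun h => by
      rcases (AddCon.eq J.reesCon).mp h with h | h
      · exact a.2 (h ▸ J.infty_mem)
      · exact a.2 h.1⟩)
    ⟨fun a b h => by
      rcases (AddCon.eq J.reesCon).mp (congrArg Subtype.val h) with h | h
      · exact Subtype.ext h
      · exact absurd h.1 a.2,
    fun ⟨x, hx⟩ => by
      obtain ⟨a, rfl⟩ := AddCon.mk'_surjective x
      refine ⟨⟨a, fun ha => hx ?_⟩, rfl⟩
      exact (AddCon.eq J.reesCon).mpr (Or.inr ⟨ha, J.infty_mem⟩)⟩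

theorem Ideal.finite_quotient (h : Finite {a : N // a ∉ J}) : Finite J.Quotient := by
  have h1 : Finite {x : J.Quotient // x ≠ infty} := Finite.of_equiv _ J.complEquiv
  have h2 : Set.Finite ({infty}ᶜ : Set J.Quotient) := h1
  have h3 : (Set.univ : Set J.Quotient) = {infty} ∪ {infty}ᶜ := (Set.union_compl_self _).symm
  exact Set.finite_univ_iff.mp (h3 ▸ (Set.finite_singleton _).union h2)

end Rees

variable {N : Type*} [Binoid N] {d : ℕ} (φ : AddUnits (Diff N) ≃+ (Fin d → ℤ))

/-- The vectors in `ℤᵈ` that belong to the elements of a subset of `N`. -/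
def latSet (A : Set N) : Set (Fin d → ℤ) := latVec φ '' {a | (a : N) ∈ A}

/-- Outside of `∞`, the elements of `N` which do not lie in `[q]I` are the lattice points outside
of the dilated translates. -/
theorem mem_frobeniusSum_iff (h0 : (0 : N) ≠ infty) (hint : IsIntegral N)
    (hcanc : IsCancellative N) {M : AddSubmonoid (Fin d → ℤ)}
    (hM : (M : Set (Fin d → ℤ)) = Set.range (latVec φ)) (I : Ideal N) {q : ℕ} (hq : 1 ≤ q)
    (a : {a : N // a ≠ infty}) :
    (a : N) ∉ I.frobeniusSum q ↔ latVec φ a ∈ latticeComplement M (latSet φ I) q := by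
  have haM : latVec φ a ∈ M := by rw [← SetLike.mem_coe, hM]; exact ⟨a, rfl⟩
  have key : (a : N) ∈ I.frobeniusSum q ↔ ∃ z ∈ latSet φ (I : Set N), latVec φ a - q • z ∈ M := by
    constructor
    · rintro (h | ⟨_, ⟨b, hb, rfl⟩, c, hc⟩)
      · exact absurd h a.2
      · have hac : q • b + c ≠ infty := hc ▸ a.2
        have hb' : b ≠ infty := by
          rintro rfl
          rw [nsmul_infty hq] at hac
          exact left_ne_infty hac rfl
        have hqb := left_ne_infty hac
        have hc' := right_ne_infty hac
        refine ⟨_, ⟨⟨b, hb'⟩, hb, rfl⟩, ?_⟩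
        have ha : a = ⟨q • b + c, hac⟩ := Subtype.ext hc
        rw [ha, latVec_add φ hqb hc', latVec_nsmul φ hint h0 hb', add_sub_cancel_left,
          ← SetLike.mem_coe, hM]
        exact ⟨_, rfl⟩
    · rintro ⟨_, ⟨b, hb, rfl⟩, h⟩
      rw [← SetLike.mem_coe, hM] at h
      obtain ⟨c, hc⟩ := h
      refine Or.inr ⟨q • b, ⟨b, hb, rfl⟩, c, ?_⟩
      have hqb := hint.nsmul_ne_infty h0 b.2 q
      refine congrArg Subtype.val (latVec_inj φ h0 hint hcanc
        (b := ⟨q • (b : N) + c, hint.add_ne_infty hqb c.2⟩) ?_)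
      rw [latVec_add φ hqb c.2, latVec_nsmul φ hint h0 b.2]
      exact (sub_eq_iff_eq_add'.mp hc.symm)
  rw [key]
  simp only [latticeComplement, Set.mem_ofPred_eq, haM, true_and, not_exists, not_and]

/-- The elements of `N` outside of `[q]I` correspond to the lattice points outside of the dilated
translates. -/
noncomputable def frobeniusComplEquiv (h0 : (0 : N) ≠ infty) (hint : IsIntegral N)
    (hcanc : IsCancellative N) {M : AddSubmonoid (Fin d → ℤ)}
    (hM : (M : Set (Fin d → ℤ)) = Set.range (latVec φ)) (I : Ideal N) {q : ℕ} (hq : 1 ≤ q) :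
    {a : N // a ∉ I.frobeniusSum q} ≃ latticeComplement M (latSet φ I) q :=
  Equiv.ofBijective
    (fun a => ⟨latVec φ ⟨a, fun h => a.2 (h ▸ Ideal.infty_mem _)⟩,
      (mem_frobeniusSum_iff φ h0 hint hcanc hM I hq ⟨a, _⟩).mp a.2⟩)
    ⟨fun a b h => Subtype.ext
      (Subtype.mk.inj (latVec_inj φ h0 hint hcanc (congrArg Subtype.val h))),
    fun ⟨z, hz⟩ => by
      have hzM : z ∈ (M : Set (Fin d → ℤ)) := hz.1
      rw [hM] at hzM
      obtain ⟨a, rfl⟩ := hzM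
      exact ⟨⟨a, (mem_frobeniusSum_iff φ h0 hint hcanc hM I hq a).mpr hz⟩, rfl⟩⟩

theorem hkFunction_eq_card (h0 : (0 : N) ≠ infty) (hint : IsIntegral N)
    (hcanc : IsCancellative N) {M : AddSubmonoid (Fin d → ℤ)}
    (hM : (M : Set (Fin d → ℤ)) = Set.range (latVec φ)) (I : Ideal N) {q : ℕ} (hq : 1 ≤ q) :
    hkFunction I q = Nat.card (latticeComplement M (latSet φ I) q) :=
  Nat.card_congr ((Ideal.complEquiv _).symm.trans (frobeniusComplEquiv φ h0 hint hcanc hM I hq))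

/-- The region attached to a generating set of the ideal `I` depends on `I` only. -/
theorem region_eq_coneComplement {S : Set (Fin d → ℤ)}
    (hS : (AddSubmonoid.closure S : Set (Fin d → ℤ)) = Set.range (latVec φ)) {A : Set N}
    {I : Ideal N} (hA : Ideal.span A = I) : region φ A = coneComplement S (latSet φ I) := by
  have hcone : cone φ = realCone S := by
    rw [← realCone_closure, hS, realCone, ← Set.range_comp]
    rfl
  have h1 : region φ A = coneComplement S (latSet φ A) := by
    ext x
    simp [region, coneComplement, hcone, latSet, latticePoint_eq]
  rw [h1]
  refine coneComplement_eq_of_forall_sub_mem ?_ ?_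
  · rintro _ ⟨a, ha, rfl⟩
    exact ⟨a, hA ▸ Ideal.subset_span A ha, rfl⟩
  · rintro _ ⟨⟨b, hb'⟩, hb, rfl⟩
    rw [← hA] at hb
    rcases hb with hb | ⟨a, ha, c, hc⟩
    · exact absurd hb hb'
    · dsimp only at hc
      subst hc
      refine ⟨_, ⟨⟨a, left_ne_infty hb'⟩, ha, rfl⟩, ?_⟩
      rw [latVec_add φ (left_ne_infty hb') (right_ne_infty hb'), add_sub_cancel_left,
        ← SetLike.mem_coe, hS]
      exact ⟨_, rfl⟩

/-- The Hilbert–Kunz function of an `N₊`-primary ideal of a normal binoid is finite and grows like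
the volume of the region attached to the ideal, which is bounded with rational volume. -/
theorem exists_region_and_tendsto_hkFunction (hfg : IsFinitelyGenerated N) (hpos : IsPositive N)
    (hint : IsIntegral N) (hcanc : IsCancellative N) (hnorm : IsNormal N)
    (I : Ideal N) (hI : I.IsPlusPrimary) :
    ∃ R : Set (Fin d → ℝ), (∀ A, Ideal.span A = I → region φ A = R) ∧ Bornology.IsBounded R ∧
      (∃ e : ℚ, volume.real R = e) ∧
      (∀ q : ℕ, 1 ≤ q → Finite (I.frobeniusSum q).Quotient) ∧
      Tendsto (fun q : ℕ => (hkFunction I q : ℝ) / (q : ℝ) ^ d) atTop (𝓝 (volume.real R)) := by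
  have h0 := hpos.1
  obtain ⟨S, hS⟩ := exists_finset_closure_eq_range_latVec φ hfg h0 hint
  have hspan := span_castVec_eq_top φ ℝ h0 hint hcanc hS
  have hsat : ∀ (z : Fin d → ℤ) (n : ℕ), 1 ≤ n →
      n • z ∈ AddSubmonoid.closure (S : Set (Fin d → ℤ)) →
        z ∈ AddSubmonoid.closure (S : Set (Fin d → ℤ)) := by
    intro z n hn hz
    rw [← SetLike.mem_coe, hS] at hz ⊢
    exact mem_range_latVec_of_nsmul φ h0 hint hcanc hnorm hn hz
  have hJ : latSet φ (I : Set N) ⊆ AddSubmonoid.closure (S : Set (Fin d → ℤ)) := by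
    rintro _ ⟨a, -, rfl⟩
    rw [hS]
    exact ⟨a, rfl⟩
  obtain ⟨A₀, hA₀, hA₀'⟩ := exists_finset_forall_sub_mem_closure S (latSet φ (I : Set N)) hJ
  have hcompl := coneComplement_eq_of_forall_sub_mem hA₀ hA₀'
  -- each nonzero generator belongs to a non-unit, which has a multiple in `I`
  have hb : Bornology.IsBounded
      (coneComplement (S : Set (Fin d → ℤ)) (latSet φ (I : Set N))) := by
    refine isBounded_coneComplement fun s hs hs0 => ?_
    have hsM : s ∈ Set.range (latVec φ) := hS ▸ AddSubmonoid.subset_closure hs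
    obtain ⟨⟨a, ha⟩, rfl⟩ := hsM
    have hplus : a ∈ plus N := fun hu => hs0 (by
      have := hpos.2 a hu
      subst this
      exact latVec_zero φ ha)
    rw [← hI] at hplus
    obtain ⟨n, hn⟩ := hplus
    have hna := hint.nsmul_ne_infty h0 ha n
    refine ⟨n, latVec φ ⟨n • a, hna⟩, ⟨_, hn, rfl⟩, ?_⟩
    rw [latVec_nsmul φ hint h0 ha, sub_self]
    exact zero_mem _
  refine ⟨_, fun A hA => region_eq_coneComplement φ hS hA, hb, ?_, ?_, ?_⟩
  · exact piecewisePoly.exists_rat_volume_eq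
      (hcompl ▸ indicator_coneComplement_mem hspan A₀) hb
  · intro q hq
    refine Ideal.finite_quotient _ ?_
    have h := (finite_latticeComplement hspan hsat hb hq).to_subtype
    exact Finite.of_equiv _ (frobeniusComplEquiv φ h0 hint hcanc hS I hq).symm
  · have h := tendsto_card_latticeComplement hspan hsat (A := A₀) (hcompl ▸ hb)
    rw [hcompl] at h
    refine h.congr' ?_
    filter_upwards [eventually_ge_atTop 1] with q hq
    rw [hkFunction_eq_card φ h0 hint hcanc hS I hq,
      latticeComplement_eq_of_forall_sub_mem hA₀ hA₀']

end Binoid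

/-! ### Extremal rays -/

/-- A finitely generated pointed cone that is not zero has an extremal ray. If `t ≠ 0` cannot be
dropped from the generators and `x + y = r t`, then comparing the coefficients of `t` on both sides
leaves a vanishing sum of combinations of the other generators. -/
theorem PointedCone.exists_extremal {K E : Type*} [Field K] [LinearOrder K]
    [IsStrictOrderedRing K] [AddCommGroup E] [Module K E] (P : Finset E)
    (hP : ∃ t ∈ P, t ≠ 0)
    (hpt : ∀ x, x ∈ PointedCone.hull K (P : Set E) → -x ∈ PointedCone.hull K (P : Set E) → x = 0) :
    ∃ t ∈ P, t ≠ 0 ∧ ∀ x ∈ PointedCone.hull K (P : Set E), ∀ y ∈ PointedCone.hull K (P : Set E),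
      (∃ r : K, 0 ≤ r ∧ x + y = r • t) → ∃ r : K, 0 ≤ r ∧ x = r • t := by
  classical
  induction P using Finset.strongInduction with
  | H P ih =>
    by_cases hred : ∃ t ∈ P, t ∈ PointedCone.hull K ((P.erase t : Finset E) : Set E)
    · obtain ⟨t, ht, htP⟩ := hred
      have heq : PointedCone.hull K ((P.erase t : Finset E) : Set E) =
          PointedCone.hull K (P : Set E) := by
        apply le_antisymm (Submodule.span_mono (Finset.coe_subset.mpr (Finset.erase_subset _ _)))
        refine Submodule.span_le.mpr fun s hs => ?_
        by_cases hst : s = t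
        · exact hst ▸ htP
        · exact PointedCone.subset_hull (Finset.mem_erase.mpr ⟨hst, hs⟩)
      have hne : ∃ s ∈ P.erase t, s ≠ 0 := by
        by_contra! hall
        obtain ⟨s, hs, hs0⟩ := hP
        have h1 : PointedCone.hull K ((P.erase t : Finset E) : Set E) ≤ ⊥ :=
          Submodule.span_le.mpr fun u hu => hall u hu
        exact hs0 (h1 (heq ▸ PointedCone.subset_hull hs))
      obtain ⟨s, hs, h⟩ := ih _ (Finset.erase_ssubset ht) hne (by rw [heq]; exact hpt)
      rw [heq] at h
      exact ⟨s, Finset.mem_of_mem_erase hs, h⟩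
    · push Not at hred
      obtain ⟨t, ht, ht0⟩ := hP
      refine ⟨t, ht, ht0, ?_⟩
      have htC : t ∈ PointedCone.hull K (P : Set E) := PointedCone.subset_hull ht
      have hsub : PointedCone.hull K ((P.erase t : Finset E) : Set E) ≤
          PointedCone.hull K (P : Set E) :=
        Submodule.span_mono (Finset.coe_subset.mpr (Finset.erase_subset _ _))
      have hdec : ∀ x ∈ PointedCone.hull K (P : Set E), ∃ a : K, 0 ≤ a ∧
          ∃ z ∈ PointedCone.hull K ((P.erase t : Finset E) : Set E), x = a • t + z := by
        intro x hx
        rw [← Finset.insert_erase ht, Finset.coe_insert] at hx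
        obtain ⟨a, z, hz, h⟩ := Submodule.mem_span_insert.mp hx
        exact ⟨a, a.2, z, hz, h⟩
      rintro x hx y hy ⟨r, hr, hxy⟩
      obtain ⟨a, ha, x', hx', rfl⟩ := hdec x hx
      obtain ⟨b, hb, y', hy', rfl⟩ := hdec y hy
      have hsum : x' + y' = (r - a - b) • t := by
        rw [sub_smul, sub_smul, ← hxy]; abel
      have hxy' := add_mem hx' hy'
      rcases lt_trichotomy (r - a - b) 0 with h | h | h
      · exfalso
        refine ht0 (hpt t htC ?_)
        have h2 : -t = (-(r - a - b))⁻¹ • (x' + y') := by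
          rw [hsum, smul_smul, inv_neg, neg_mul, inv_mul_cancel₀ h.ne, neg_one_smul]
        rw [h2]
        exact PointedCone.smul_mem _ (inv_nonneg.mpr (neg_nonneg.mpr h.le)) (hsub hxy')
      · have h3 : x' = 0 := by
          rw [h, zero_smul] at hsum
          exact hpt x' (hsub hx') (by rw [neg_eq_of_add_eq_zero_right hsum]; exact hsub hy')
        exact ⟨a, ha, by rw [h3, add_zero]⟩
      · exfalso
        refine hred t ht ?_
        have h2 : t = (r - a - b)⁻¹ • (x' + y') := by
          rw [hsum, smul_smul, inv_mul_cancel₀ h.ne', one_smul]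
        have h3 := PointedCone.smul_mem _ (inv_nonneg.mpr h.le) hxy'
        rwa [← h2] at h3

namespace Binoid

/-! ### The dimension of a binoid -/

variable {N : Type*} [Binoid N] {d : ℕ}

theorem Ideal.IsPrime.zero_notMem {p : Ideal N} (hp : p.IsPrime) : (0 : N) ∉ p := fun h =>
  hp.1 (Set.eq_univ_of_forall fun a => by
    have := p.add_mem 0 h a
    rwa [zero_add] at this)

theorem Ideal.ne_infty_of_notMem {p : Ideal N} {a : N} (ha : a ∉ p) : a ≠ infty :=
  fun h => ha (h ▸ p.infty_mem)

theorem Ideal.IsPrime.add_notMem {p : Ideal N} (hp : p.IsPrime) {a b : N} (ha : a ∉ p)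
    (hb : b ∉ p) : a + b ∉ p := fun h => (hp.2 a b h).elim ha hb

theorem Ideal.IsPrime.nsmul_notMem {p : Ideal N} (hp : p.IsPrime) {a : N} (ha : a ∉ p) (n : ℕ) :
    n • a ∉ p := by
  induction n with
  | zero => rw [zero_nsmul]; exact hp.zero_notMem
  | succ n ih => rw [succ_nsmul]; exact hp.add_notMem ih ha

theorem Ideal.left_notMem {p : Ideal N} {a b : N} (h : a + b ∉ p) : a ∉ p :=
  fun ha => h (p.add_mem a ha b)

theorem Ideal.notMem_of_nsmul {p : Ideal N} {a : N} {n : ℕ} (hn : 1 ≤ n) (h : n • a ∉ p) :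
    a ∉ p := by
  obtain ⟨k, rfl⟩ := Nat.exists_eq_add_of_le hn
  rw [add_nsmul, one_nsmul] at h
  exact Ideal.left_notMem h

variable (φ : AddUnits (Diff N) ≃+ (Fin d → ℤ))

/-- The rational vector of an element of `N^•`. -/
noncomputable def ratVec (a : {a : N // a ≠ infty}) : Fin d → ℚ := castVec ℚ d (latVec φ a)

theorem ratVec_add {a b : N} (ha : a ≠ infty) (hb : b ≠ infty) (h : a + b ≠ infty) :
    ratVec φ ⟨a + b, h⟩ = ratVec φ ⟨a, ha⟩ + ratVec φ ⟨b, hb⟩ := by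
  rw [ratVec, latVec_add φ ha hb, map_add]; rfl

theorem ratVec_zero (h : (0 : N) ≠ infty) : ratVec φ ⟨0, h⟩ = 0 := by
  rw [ratVec, latVec_zero, map_zero]

theorem ratVec_nsmul (hint : IsIntegral N) (h0 : (0 : N) ≠ infty) {a : N} (ha : a ≠ infty)
    (n : ℕ) (h : n • a ≠ infty) : ratVec φ ⟨n • a, h⟩ = n • ratVec φ ⟨a, ha⟩ := by
  rw [ratVec, latVec_nsmul φ hint h0 ha, map_nsmul]; rfl

theorem ratVec_inj (h0 : (0 : N) ≠ infty) (hint : IsIntegral N) (hcanc : IsCancellative N)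
    {a b : {a : N // a ≠ infty}} (h : ratVec φ a = ratVec φ b) : a = b :=
  latVec_inj φ h0 hint hcanc (castVec_injective ℚ h)

/-- The rational span of the face `N ∖ p` that is the complement of a prime ideal `p`. -/
noncomputable def faceSpan (p : Ideal N) : Submodule ℚ (Fin d → ℚ) :=
  Submodule.span ℚ (ratVec φ '' {a | (a : N) ∉ p})

theorem ratVec_mem_faceSpan {p : Ideal N} {a : {a : N // a ≠ infty}} (ha : (a : N) ∉ p) :
    ratVec φ a ∈ faceSpan φ p :=
  Submodule.subset_span ⟨a, ha, rfl⟩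

/-- A vector in the span of a face has a multiple that is a difference of elements
of the face. -/
theorem exists_nsmul_eq_of_mem_faceSpan (hint : IsIntegral N) (h0 : (0 : N) ≠ infty)
    {p : Ideal N} (hp : p.IsPrime) {x : Fin d → ℚ} (hx : x ∈ faceSpan φ p) :
    ∃ (n : ℕ) (f g : {a : N // a ≠ infty}), 1 ≤ n ∧ (f : N) ∉ p ∧ (g : N) ∉ p ∧
      n • x = ratVec φ f - ratVec φ g := by
  have hsm : ∀ (n : ℕ) (f : {a : N // a ≠ infty}), (f : N) ∉ p →
      ∃ f' : {a : N // a ≠ infty}, (f' : N) ∉ p ∧ ratVec φ f' = n • ratVec φ f :=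
    fun n f hf => ⟨⟨n • (f : N), hint.nsmul_ne_infty h0 f.2 n⟩, hp.nsmul_notMem hf n,
      ratVec_nsmul φ hint h0 f.2 n _⟩
  have hadd : ∀ f g : {a : N // a ≠ infty}, (f : N) ∉ p → (g : N) ∉ p →
      ∃ f' : {a : N // a ≠ infty}, (f' : N) ∉ p ∧ ratVec φ f' = ratVec φ f + ratVec φ g :=
    fun f g hf hg => ⟨⟨(f : N) + g, hint.add_ne_infty f.2 g.2⟩, hp.add_notMem hf hg,
      ratVec_add φ f.2 g.2 _⟩
  induction hx using Submodule.span_induction with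
  | mem x hx =>
    obtain ⟨a, ha, rfl⟩ := hx
    exact ⟨1, a, ⟨0, h0⟩, le_rfl, ha, hp.zero_notMem, by simp [ratVec_zero]⟩
  | zero => exact ⟨1, ⟨0, h0⟩, ⟨0, h0⟩, le_rfl, hp.zero_notMem, hp.zero_notMem, by simp⟩
  | add x y _ _ hx hy =>
    obtain ⟨n, f, g, hn, hf, hg, hx⟩ := hx
    obtain ⟨m, f', g', hm, hf', hg', hy⟩ := hy
    obtain ⟨mf, hmf, emf⟩ := hsm m f hf
    obtain ⟨mg, hmg, emg⟩ := hsm m g hg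
    obtain ⟨nf, hnf, enf⟩ := hsm n f' hf'
    obtain ⟨ng, hng, eng⟩ := hsm n g' hg'
    obtain ⟨F, hF, eF⟩ := hadd mf nf hmf hnf
    obtain ⟨G, hG, eG⟩ := hadd mg ng hmg hng
    refine ⟨n * m, F, G, Nat.mul_pos hn hm, hF, hG, ?_⟩
    rw [eF, eG, emf, emg, enf, eng, smul_add]
    nth_rw 1 [mul_comm n m]
    rw [mul_smul, mul_smul, hx, hy, smul_sub, smul_sub]
    abel
  | smul r x _ hx =>
    obtain ⟨n, f, g, hn, hf, hg, hx⟩ := hx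
    obtain ⟨k, hk | hk⟩ := r.num.eq_nat_or_neg
    all_goals
      obtain ⟨kf, hkf, ekf⟩ := hsm k f hf
      obtain ⟨kg, hkg, ekg⟩ := hsm k g hg
      have h1 : (r.den * n) • r • x = r.num • (n • x) := by
        have h2 : (r.den : ℚ) * r = r.num := Rat.den_mul_eq_num r
        rw [← Nat.cast_smul_eq_nsmul ℚ, ← Nat.cast_smul_eq_nsmul ℚ n x,
          ← Int.cast_smul_eq_zsmul ℚ, smul_smul, smul_smul, ← h2]
        congr 1
        push_cast
        ring
    · refine ⟨r.den * n, kf, kg, Nat.mul_pos r.den_pos hn, hkf, hkg, ?_⟩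
      rw [h1, hx, hk, natCast_zsmul, smul_sub, ekf, ekg]
    · refine ⟨r.den * n, kg, kf, Nat.mul_pos r.den_pos hn, hkg, hkf, ?_⟩
      rw [h1, hx, hk, neg_smul, natCast_zsmul, smul_sub, ekf, ekg]
      abel

/-- A face consists of all elements of `N^•` in its span. -/
theorem notMem_of_ratVec_mem_faceSpan (hint : IsIntegral N) (h0 : (0 : N) ≠ infty)
    (hcanc : IsCancellative N) {p : Ideal N} (hp : p.IsPrime) {a : {a : N // a ≠ infty}}
    (ha : ratVec φ a ∈ faceSpan φ p) : (a : N) ∉ p := by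
  obtain ⟨n, f, g, hn, hf, hg, h⟩ := exists_nsmul_eq_of_mem_faceSpan φ hint h0 hp ha
  have hna := hint.nsmul_ne_infty h0 a.2 n
  have h1 : (⟨n • (a : N) + g, hint.add_ne_infty hna g.2⟩ : {a : N // a ≠ infty}) = f := by
    apply ratVec_inj φ h0 hint hcanc
    rw [ratVec_add φ hna g.2, ratVec_nsmul φ hint h0 a.2, h, sub_add_cancel]
  have h2 : n • (a : N) + g ∉ p := by rw [← h1] at hf; exact hf
  exact Ideal.notMem_of_nsmul hn (Ideal.left_notMem h2)

theorem faceSpan_lt_of_lt (hint : IsIntegral N) (h0 : (0 : N) ≠ infty)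
    (hcanc : IsCancellative N) {p p' : Ideal N} (hp' : p'.IsPrime)
    (h : p < p') : faceSpan φ p' < faceSpan φ p := by
  refine lt_of_le_of_ne (Submodule.span_mono (Set.image_mono fun a ha hap => ha (h.le hap))) ?_
  intro heq
  obtain ⟨a, hap', hap⟩ := SetLike.exists_of_lt h
  have ha := Ideal.ne_infty_of_notMem hap
  have h1 : ratVec φ ⟨a, ha⟩ ∈ faceSpan φ p' := heq ▸ ratVec_mem_faceSpan φ hap
  exact notMem_of_ratVec_mem_faceSpan φ hint h0 hcanc hp' h1 hap'

/-- Every point of the cone over the images of `N^•` under a linear map has a positive multiple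
which is such an image. -/
theorem exists_nsmul_eq_of_mem_hull {U : Type*} [AddCommGroup U] [Module ℚ U]
    (π : (Fin d → ℚ) →ₗ[ℚ] U) (hint : IsIntegral N) (h0 : (0 : N) ≠ infty) {x : U}
    (hx : x ∈ PointedCone.hull ℚ (Set.range fun a => π (ratVec φ a))) :
    ∃ (n : ℕ) (a : {a : N // a ≠ infty}), 1 ≤ n ∧ n • x = π (ratVec φ a) := by
  have hsm : ∀ (n : ℕ) (f : {a : N // a ≠ infty}),
      ∃ f' : {a : N // a ≠ infty}, ratVec φ f' = n • ratVec φ f :=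
    fun n f => ⟨⟨n • (f : N), hint.nsmul_ne_infty h0 f.2 n⟩, ratVec_nsmul φ hint h0 f.2 n _⟩
  induction hx using Submodule.span_induction with
  | mem x hx =>
    obtain ⟨a, rfl⟩ := hx
    exact ⟨1, a, le_rfl, one_nsmul _⟩
  | zero => exact ⟨1, ⟨0, h0⟩, le_rfl, by simp [ratVec_zero]⟩
  | add x y _ _ hx hy =>
    obtain ⟨n, a, hn, hx⟩ := hx
    obtain ⟨m, b, hm, hy⟩ := hy
    obtain ⟨ma, hma⟩ := hsm m a
    obtain ⟨nb, hnb⟩ := hsm n b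
    refine ⟨n * m, ⟨(ma : N) + nb, hint.add_ne_infty ma.2 nb.2⟩, Nat.mul_pos hn hm, ?_⟩
    rw [ratVec_add φ ma.2 nb.2, map_add, Subtype.coe_eta, Subtype.coe_eta, hma, hnb, map_nsmul,
      map_nsmul, ← hx, ← hy, smul_add]
    nth_rw 1 [mul_comm n m]
    rw [mul_smul, mul_smul]
  | smul r x _ hx =>
    obtain ⟨n, a, hn, hx⟩ := hx
    obtain ⟨k, hk⟩ := Int.eq_ofNat_of_zero_le (Rat.num_nonneg.mpr r.2)
    obtain ⟨ka, hka⟩ := hsm k a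
    refine ⟨(r : ℚ).den * n, ka, Nat.mul_pos (r : ℚ).den_pos hn, ?_⟩
    rw [hka, map_nsmul, ← hx]
    have h2 : ((r : ℚ).den : ℚ) * r = k := by
      rw [Rat.den_mul_eq_num, hk]; simp
    have h3 : r • x = (r : ℚ) • x := rfl
    rw [h3, ← Nat.cast_smul_eq_nsmul ℚ, ← Nat.cast_smul_eq_nsmul ℚ n x,
      ← Nat.cast_smul_eq_nsmul ℚ k, smul_smul, smul_smul, ← h2]
    congr 1
    push_cast
    ring

/-- The elements of `N^•` that a linear map `π` sends to the ray spanned by `t` form a face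
if the ray is extremal in the image; this is the complementary prime ideal. -/
def rayIdeal {U : Type*} [AddCommGroup U] [Module ℚ U] (π : (Fin d → ℚ) →ₗ[ℚ] U) (t : U)
    (hext : ∀ a b : {a : N // a ≠ infty},
      (∃ r : ℚ, 0 ≤ r ∧ π (ratVec φ a) + π (ratVec φ b) = r • t) →
        ∃ r : ℚ, 0 ≤ r ∧ π (ratVec φ a) = r • t) : Ideal N where
  carrier := {a | ∀ h : a ≠ infty, ¬ ∃ r : ℚ, 0 ≤ r ∧ π (ratVec φ ⟨a, h⟩) = r • t}
  nonempty := ⟨infty, fun h => absurd rfl h⟩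
  add_mem := by
    intro a ha b hab h
    refine ha (left_ne_infty hab) (hext _ ⟨b, right_ne_infty hab⟩ ?_)
    rwa [ratVec_add φ (left_ne_infty hab) (right_ne_infty hab), map_add] at h

theorem notMem_rayIdeal_iff {U : Type*} [AddCommGroup U] [Module ℚ U]
    (π : (Fin d → ℚ) →ₗ[ℚ] U) (t : U)
    (hext : ∀ a b : {a : N // a ≠ infty},
      (∃ r : ℚ, 0 ≤ r ∧ π (ratVec φ a) + π (ratVec φ b) = r • t) →
        ∃ r : ℚ, 0 ≤ r ∧ π (ratVec φ a) = r • t) (a : N) :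
    a ∉ rayIdeal φ π t hext ↔
      ∃ h : a ≠ infty, ∃ r : ℚ, 0 ≤ r ∧ π (ratVec φ ⟨a, h⟩) = r • t := by
  change (¬ ∀ h : a ≠ infty, ¬ ∃ r : ℚ, 0 ≤ r ∧ π (ratVec φ ⟨a, h⟩) = r • t) ↔ _
  push Not
  rfl

theorem isPrime_rayIdeal {U : Type*} [AddCommGroup U] [Module ℚ U] (hint : IsIntegral N)
    (h0 : (0 : N) ≠ infty) (π : (Fin d → ℚ) →ₗ[ℚ] U) (t : U)
    (hext : ∀ a b : {a : N // a ≠ infty},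
      (∃ r : ℚ, 0 ≤ r ∧ π (ratVec φ a) + π (ratVec φ b) = r • t) →
        ∃ r : ℚ, 0 ≤ r ∧ π (ratVec φ a) = r • t) : (rayIdeal φ π t hext).IsPrime := by
  constructor
  · intro h
    have h1 : (0 : N) ∉ rayIdeal φ π t hext := by
      rw [notMem_rayIdeal_iff]
      exact ⟨h0, 0, le_rfl, by rw [ratVec_zero]; simp⟩
    exact h1 (h ▸ Set.mem_univ (0 : N) : (0 : N) ∈ (rayIdeal φ π t hext : Set N))
  · intro a b hab
    by_contra! hcon
    obtain ⟨ha, hb⟩ := hcon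
    obtain ⟨ha, r, hr, har⟩ := (notMem_rayIdeal_iff φ π t hext a).mp ha
    obtain ⟨hb, r', hr', hbr⟩ := (notMem_rayIdeal_iff φ π t hext b).mp hb
    refine (notMem_rayIdeal_iff φ π t hext (a + b)).mpr
      ⟨hint.add_ne_infty ha hb, r + r', add_nonneg hr hr', ?_⟩ hab
    rw [ratVec_add φ ha hb, map_add, har, hbr, add_smul]

/-- A face whose span is not the whole space is contained in a larger face whose span has dimension
at most one more: an extremal ray of the image of `N^•` modulo the span of the given face yields
such a face. -/
theorem exists_isPrime_lt_finrank_le (hfg : IsFinitelyGenerated N) (hint : IsIntegral N)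
    (h0 : (0 : N) ≠ infty) (hcanc : IsCancellative N) {p : Ideal N} (hp : p.IsPrime)
    (hrank : Module.finrank ℚ (faceSpan φ p) < d) :
    ∃ p' : Ideal N, p'.IsPrime ∧ p' < p ∧
      Module.finrank ℚ (faceSpan φ p') ≤ Module.finrank ℚ (faceSpan φ p) + 1 := by
  classical
  obtain ⟨S, hS⟩ := exists_finset_closure_eq_range_latVec φ hfg h0 hint
  have hspan := span_castVec_eq_top φ ℚ h0 hint hcanc hS
  set W := faceSpan φ p with hW
  set π := W.mkQ with hπ
  have hπ0 : ∀ x, π x = 0 ↔ x ∈ W := fun x => Submodule.Quotient.mk_eq_zero W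
  set P : Finset ((Fin d → ℚ) ⧸ W) := S.image fun s => π (castVec ℚ d s) with hP
  have hSr : ∀ s ∈ S, ∃ a, latVec φ a = s := fun s hs => by
    have : s ∈ Set.range (latVec φ) := hS ▸ AddSubmonoid.subset_closure hs
    exact this
  have hPsub : PointedCone.hull ℚ (P : Set ((Fin d → ℚ) ⧸ W)) ≤
      PointedCone.hull ℚ (Set.range fun a => π (ratVec φ a)) := by
    refine Submodule.span_mono ?_
    intro t ht
    obtain ⟨s, hs, rfl⟩ := Finset.mem_image.mp ht
    obtain ⟨a, rfl⟩ := hSr s hs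
    exact ⟨a, rfl⟩
  have hmemP : ∀ a, π (ratVec φ a) ∈ PointedCone.hull ℚ (P : Set ((Fin d → ℚ) ⧸ W)) := by
    intro a
    have ha : latVec φ a ∈ AddSubmonoid.closure (S : Set (Fin d → ℤ)) := by
      rw [← SetLike.mem_coe, hS]; exact ⟨a, rfl⟩
    rw [ratVec]
    generalize latVec φ a = z at ha
    induction ha using AddSubmonoid.closure_induction with
    | mem z hz => exact PointedCone.subset_hull (Finset.mem_image_of_mem _ hz)
    | zero => simp
    | add x y _ _ hx hy => rw [map_add, map_add]; exact add_mem hx hy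
  have hne : ∃ t ∈ P, t ≠ 0 := by
    by_contra! hall
    have h1 : (⊤ : Submodule ℚ (Fin d → ℚ)) ≤ W := by
      rw [← hspan]
      refine Submodule.span_le.mpr ?_
      rintro _ ⟨s, hs, rfl⟩
      exact (hπ0 _).mp (hall _ (Finset.mem_image_of_mem _ hs))
    rw [top_le_iff.mp h1, finrank_top, Module.finrank_fin_fun] at hrank
    exact lt_irrefl _ hrank
  have hpt : ∀ x, x ∈ PointedCone.hull ℚ (P : Set ((Fin d → ℚ) ⧸ W)) →
      -x ∈ PointedCone.hull ℚ (P : Set ((Fin d → ℚ) ⧸ W)) → x = 0 := by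
    intro x hx hnx
    obtain ⟨n, a, hn, ha⟩ := exists_nsmul_eq_of_mem_hull φ π hint h0 (hPsub hx)
    obtain ⟨m, b, hm, hb⟩ := exists_nsmul_eq_of_mem_hull φ π hint h0 (hPsub hnx)
    have hma := hint.nsmul_ne_infty h0 a.2 m
    have hnb := hint.nsmul_ne_infty h0 b.2 n
    have h1 : ratVec φ ⟨m • (a : N) + n • (b : N), hint.add_ne_infty hma hnb⟩ ∈ W := by
      rw [← hπ0, ratVec_add φ hma hnb, ratVec_nsmul φ hint h0 a.2, ratVec_nsmul φ hint h0 b.2,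
        map_add, map_nsmul, map_nsmul, ← ha, ← hb, smul_smul, smul_smul, mul_comm n m, smul_neg,
        add_neg_cancel]
    have h2 := notMem_of_ratVec_mem_faceSpan φ hint h0 hcanc hp h1
    have h3 : (a : N) ∉ p := Ideal.notMem_of_nsmul hm (Ideal.left_notMem h2)
    have h4 : π (ratVec φ a) = 0 := (hπ0 _).mpr (ratVec_mem_faceSpan φ h3)
    rw [h4, ← Nat.cast_smul_eq_nsmul ℚ] at ha
    exact (smul_eq_zero.mp ha).resolve_left (by exact_mod_cast (by omega : n ≠ 0))
  obtain ⟨t, htP, ht0, hext⟩ := PointedCone.exists_extremal P hne hpt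
  obtain ⟨s, hs, hst⟩ := Finset.mem_image.mp htP
  obtain ⟨c, rfl⟩ := hSr s hs
  have hct : π (ratVec φ c) = t := hst
  have hext' : ∀ a b : {a : N // a ≠ infty},
      (∃ r : ℚ, 0 ≤ r ∧ π (ratVec φ a) + π (ratVec φ b) = r • t) →
        ∃ r : ℚ, 0 ≤ r ∧ π (ratVec φ a) = r • t :=
    fun a b h => hext _ (hmemP a) _ (hmemP b) h
  refine ⟨rayIdeal φ π t hext', isPrime_rayIdeal φ hint h0 π t hext', ?_, ?_⟩
  · refine lt_of_le_of_ne (fun a ha => ?_) fun heq => ?_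
    · by_contra hap
      refine (notMem_rayIdeal_iff φ π t hext' a).mpr
        ⟨Ideal.ne_infty_of_notMem hap, 0, le_rfl, ?_⟩ ha
      rw [zero_smul, hπ0]
      exact ratVec_mem_faceSpan φ hap
    · have h1 : (c : N) ∉ rayIdeal φ π t hext' :=
        (notMem_rayIdeal_iff φ π t hext' c).mpr ⟨c.2, 1, zero_le_one, by rw [one_smul]; exact hct⟩
      rw [heq] at h1
      exact ht0 (hct ▸ (hπ0 _).mpr (ratVec_mem_faceSpan φ h1))
  · have hle : faceSpan φ (rayIdeal φ π t hext') ≤ W ⊔ Submodule.span ℚ {ratVec φ c} := by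
      refine Submodule.span_le.mpr ?_
      rintro _ ⟨a, ha, rfl⟩
      obtain ⟨_, r, _, hr⟩ := (notMem_rayIdeal_iff φ π t hext' a).mp ha
      have h1 : ratVec φ a - r • ratVec φ c ∈ W := by
        rw [← hπ0, map_sub, map_smul, hct, sub_eq_zero]
        exact hr
      have h2 : ratVec φ a = (ratVec φ a - r • ratVec φ c) + r • ratVec φ c := by abel
      rw [SetLike.mem_coe, h2]
      exact Submodule.add_mem_sup h1
        (Submodule.smul_mem _ _ (Submodule.mem_span_singleton_self _))
    calc Module.finrank ℚ (faceSpan φ (rayIdeal φ π t hext'))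
        ≤ Module.finrank ℚ ↥(W ⊔ Submodule.span ℚ {ratVec φ c}) := Submodule.finrank_mono hle
      _ ≤ Module.finrank ℚ W + Module.finrank ℚ (Submodule.span ℚ {ratVec φ c}) :=
        Submodule.finrank_add_le_finrank_add_finrank _ _
      _ ≤ Module.finrank ℚ W + 1 := by
        gcongr
        exact (finrank_span_le_card _).trans (by simp)

/-- The ideal of all non-units. -/
def plusIdeal (N : Type*) [Binoid N] (h0 : (0 : N) ≠ infty) : Ideal N where
  carrier := plus N
  nonempty := ⟨infty, fun h => by
    obtain ⟨b, hb⟩ := h.exists_neg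
    rw [infty_add] at hb
    exact h0 hb.symm⟩
  add_mem := fun _ ha _ hab => ha (IsAddUnit.add_iff.mp hab).1

theorem isPrime_plusIdeal (h0 : (0 : N) ≠ infty) : (plusIdeal N h0).IsPrime := by
  constructor
  · intro h
    have h1 : (0 : N) ∈ plus N := (h ▸ Set.mem_univ (0 : N) : (0 : N) ∈ (plusIdeal N h0 : Set N))
    exact h1 isAddUnit_zero
  · intro a b hab
    by_contra! hcon
    obtain ⟨ha, hb⟩ := hcon
    exact hab (IsAddUnit.add_iff.mpr ⟨not_not.mp ha, not_not.mp hb⟩)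

/-- The dimension of `N` is the rank of its difference group: along a chain of prime ideals the
dimensions of the spans of the complementary faces are strictly decreasing, and starting with
the face `0` one may enlarge faces in such a way that the dimension grows by at most one. -/
theorem dim_eq (φ : AddUnits (Diff N) ≃+ (Fin d → ℤ)) (hfg : IsFinitelyGenerated N)
    (hpos : IsPositive N) (hint : IsIntegral N) (hcanc : IsCancellative N) : dim N = d := by
  have h0 := hpos.1
  have hle : ∀ p : Ideal N, Module.finrank ℚ (faceSpan φ p) ≤ d := fun p =>
    (Submodule.finrank_le _).trans_eq (Module.finrank_fin_fun ℚ)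
  apply le_antisymm
  · have hmono : StrictMono fun p : {p : Ideal N // p.IsPrime} =>
        d - Module.finrank ℚ (faceSpan φ p.1) := by
      intro p p' h
      have h1 := Submodule.finrank_lt_finrank_of_lt
        (faceSpan_lt_of_lt φ hint h0 hcanc p'.2 (show p.1 < p'.1 from h))
      have h2 := hle p.1
      dsimp only
      omega
    refine iSup_le fun l => ?_
    have h1 := (l.map _ hmono).head_add_length_le_nat
    have h2 : (l.map _ hmono).last ≤ d := Nat.sub_le _ _
    have h3 : (l.map _ hmono).length = l.length := rfl
    exact_mod_cast (by omega : l.length ≤ d)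
  · have hheight : ∀ (k : ℕ) (p : {p : Ideal N // p.IsPrime}),
        Module.finrank ℚ (faceSpan φ p.1) + k ≤ d → (k : ℕ∞) ≤ Order.height p := by
      intro k
      induction k with
      | zero => simp
      | succ k ih =>
        intro p hp
        obtain ⟨p', hp', hlt, hrank⟩ :=
          exists_isPrime_lt_finrank_le φ hfg hint h0 hcanc p.2 (by omega)
        have h1 := ih ⟨p', hp'⟩ (by dsimp only; omega)
        have h2 : (⟨p', hp'⟩ : {p : Ideal N // p.IsPrime}) < p := hlt
        calc ((k + 1 : ℕ) : ℕ∞) = k + 1 := by push_cast; rfl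
          _ ≤ Order.height (⟨p', hp'⟩ : {p : Ideal N // p.IsPrime}) + 1 := by gcongr
          _ ≤ Order.height p := Order.height_add_one_le h2
    have hbot : faceSpan φ (plusIdeal N h0) = ⊥ := by
      rw [faceSpan, Submodule.span_eq_bot]
      rintro _ ⟨⟨a, ha⟩, hu, rfl⟩
      have := hpos.2 a (not_not.mp hu)
      subst this
      exact ratVec_zero φ ha
    have h1 := hheight d ⟨_, isPrime_plusIdeal h0⟩ (by rw [hbot, finrank_bot, zero_add])
    exact (WithBot.coe_le_coe.mpr h1).trans (Order.height_le_krullDim _)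

end Binoid

/-! ### The Hilbert–Kunz multiplicity -/

theorem mainTheorem2 (N : Type*) [Binoid N]
    (hfg : Binoid.IsFinitelyGenerated N) (hpos : Binoid.IsPositive N)
    (hint : Binoid.IsIntegral N) (hcanc : Binoid.IsCancellative N)
    (htf : Binoid.IsTorsionFree N) (hnorm : Binoid.IsNormal N)
    (I : Binoid.Ideal N) (hI : I.IsPlusPrimary) :
    ∃ (d : ℕ) (e : ℚ), Binoid.dim N = d ∧ Binoid.HasHKMultiplicity I (e : ℝ) ∧
      Nonempty (AddUnits (Binoid.Diff N) ≃+ (Fin d → ℤ)) ∧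
      ∀ (φ : AddUnits (Binoid.Diff N) ≃+ (Fin d → ℤ)) (A : Set N), Binoid.Ideal.span A = I →
        Bornology.IsBounded (Binoid.region φ A) ∧
        volume (Binoid.region φ A) = ENNReal.ofReal (e : ℝ) := by
  obtain ⟨d, ⟨φ₀⟩⟩ := Binoid.exists_addUnits_diff_equiv hfg hpos.1 hint hcanc htf
  have hdim := Binoid.dim_eq φ₀ hfg hpos hint hcanc
  obtain ⟨R₀, -, -, ⟨e, he⟩, hfin, hlim⟩ :=
    Binoid.exists_region_and_tendsto_hkFunction φ₀ hfg hpos hint hcanc hnorm I hI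
  rw [he] at hlim
  refine ⟨d, e, hdim, ⟨d, hdim, hfin, hlim⟩, ⟨φ₀⟩, fun φ A hA => ?_⟩
  obtain ⟨R, hR, hb, -, -, hlimR⟩ :=
    Binoid.exists_region_and_tendsto_hkFunction φ hfg hpos hint hcanc hnorm I hI
  -- the volume is the same for all identifications, as it is the limit of the same sequence
  rw [hR A hA, ← tendsto_nhds_unique hlimR hlim]
  exact ⟨hb, (ofReal_measureReal hb.measure_lt_top.ne).symm⟩
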